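/- **Setting.** Let $f:\mathbb R^d\to\mathbb R$ be twice differentiable and bounded below, and let $L_f,M_f>0$ satisfy $\|\nabla f(x)-\nabla f(y)\|\le L_f\|x-y\|$ and $\|\nabla^2 f(x)-\nabla^2 f(y)\|\le M_f\|x-y\|$ for all $x,y\in\mathbb R^d$ (Euclidean norm and the operator norm it induces). **Algorithm.** The inputs are $x_{\mathrm{init}}\in\mathbb R^d$, $L_{\mathrm{init}},M_0>0$, $\alpha>1$ and $0<\beta\le1$. Put $\theta_k=\frac{k}{k+1}$. Start with $x_0=y_0=x_{\mathrm{init}}$, $L=L_{\mathrm{init}}$, $k=0$, $K=0$, and repeat the following iteration: increase $k$ and $K$ by $1$, set $$x_k=y_{k-1}-\tfrac1L\nabla f(y_{k-1}),\qquad y_k=x_k+\theta_k(x_k-x_{k-1}),\qquad S_k=\sum_{i=1}^k\|x_i-x_{i-1}\|^2,$$ and then * if $f(x_k)>f(x_0)-\frac{L S_k}{2(k+1)}$, restart with $(x_0,y_0)\leftarrow(x_{k-1},x_{k-1})$, $L\leftarrow\alpha L$, $k\leftarrow0$; * otherwise, if $(k+1)^5M_k^2S_k>L^2$, restart with $(x_0,y_0)\leftarrow(x_k,x_k)$,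 $L\leftarrow\beta L$, $k\leftarrow0$. The counter $K$ is never reset. Within each period between two restarts, let $$Z_k=\sum_{i=0}^{k-1}\prod_{j=i+1}^{k-1}\theta_j,\qquad \bar y_k=\frac1{Z_k}\sum_{i=0}^{k-1}\Bigl(\prod_{j=i+1}^{k-1}\theta_j\Bigr)y_i ,$$ and let $M_k$ ($k\ge1$, starting from the input $M_0$ in every period) be defined by one of the following two rules, the same one throughout the run. * Basic rule: $M_k$ is the maximum of $M_{k-1}$, $$\frac{12\bigl(f(y_k)-f(x_k)-\frac12\langle\nabla f(y_k)+\nabla f(x_k),y_k-x_k\rangle\bigr)}{\|y_k-x_k\|^3}\quad\text{and}\quad\frac{\|\nabla f(y_k)+\theta_k\nabla f(x_{k-1})-(1+\theta_k)\nabla f(x_k)\|}{\theta_k\|x_k-x_{k-1}\|^2}.$$ * Extended rule: $M_k$ is the maximum of these three quantities and $$\frac{16\bigl(Z_k^2\|\nabla f(\bar y_k)\|-Z_kL\|x_k-x_{k-1}\|\bigr)}{(k-1)(k+5)^2S_k}.$$ A term of the form $0/0$ is omitted from the maximum. **Theorem.** Let $\bar L=\max\{L_{\mathrm{init}},\alpha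 L_f\}$, $\bar M=\max\{M_0,M_f\}$ and $\Delta=f(x_{\mathrm{init}})-\inf_{x\in\mathbb R^d}f(x)$. Given $L_f,M_f,L_{\mathrm{init}},M_0>0$ and $\alpha>1$, there are constants $C\ge0$ and $\varepsilon_0>0$, depending only on these five numbers, such that for all $0<\beta\le1$, all $d$, $f$ and $x_{\mathrm{init}}$ as above, and all $0<\varepsilon\le\varepsilon_0$ the following holds. With either rule for $M_k$, there is an iteration at which $\|\nabla f(\bar y_k)\|\le\varepsilon$, and when this happens for the first time, the total iteration count $K$ satisfies $$K\le\Bigl(70+108\,\frac{\bar M^{1/4}}{M_0^{1/4}}\log_\alpha\frac1\beta\Bigr)\frac{\bar L^{1/2}\bar M^2\Delta}{\varepsilon^{7/4}M_0^{7/4}}+C\varepsilon^{-1/4}.$$ If $M_k$ is computed with the extended rule and $\beta=1$, then moreover $$K\le70\,\frac{\bar L^{1/2}\bar M^{1/4}\Delta}{\varepsilon^{7/4}}+C\varepsilon^{-1/4}.$$ -/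

import Mathlib

noncomputable section

namespace RestartedAGD

/-- The acceleration parameter `θ_k = k / (k + 1)`. -/
def theta (k : ℕ) : ℝ := (k : ℝ) / ((k : ℝ) + 1)

/-- The normalizing constant `Z_k = ∑_{i=0}^{k-1} ∏_{j=i+1}^{k-1} θ_j`. -/
def Z (k : ℕ) : ℝ := ∑ i ∈ Finset.range k, ∏ j ∈ Finset.Ico (i + 1) k, theta j

/-- The averaging weight `p_{k,i} = (1 / Z_k) ∏_{j=i+1}^{k-1} θ_j`. -/
def weight (k i : ℕ) : ℝ := 1 / Z k * ∏ j ∈ Finset.Ico (i + 1) k, theta j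

section Epoch

variable {E : Type*} [NormedAddCommGroup E] [InnerProductSpace ℝ E] [CompleteSpace E]

/-- The pair `(x_k, y_k)` in an epoch with starting point `x₀` and estimate `L`:
`x_0 = y_0 = x₀`, and `x_k = y_{k-1} - (1/L) ∇f(y_{k-1})`, `y_k = x_k + θ_k (x_k - x_{k-1})`
for `k ≥ 1`. -/
def iter (f : E → ℝ) (L : ℝ) (x₀ : E) : ℕ → E × E
  | 0 => (x₀, x₀)
  | k + 1 =>
    let x := (iter f L x₀ k).1
    let y := (iter f L x₀ k).2
    let x' := y - (1 / L) • gradient f y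
    (x', x' + theta (k + 1) • (x' - x))

/-- The iterate `x_k` of the epoch. -/
def xSeq (f : E → ℝ) (L : ℝ) (x₀ : E) (k : ℕ) : E := (iter f L x₀ k).1

/-- The iterate `y_k` of the epoch. -/
def ySeq (f : E → ℝ) (L : ℝ) (x₀ : E) (k : ℕ) : E := (iter f L x₀ k).2

/-- `S_k = ∑_{i=1}^k ‖x_i - x_{i-1}‖²`. -/
def S (f : E → ℝ) (L : ℝ) (x₀ : E) (k : ℕ) : ℝ :=
  ∑ i ∈ Finset.range k, ‖xSeq f L x₀ (i + 1) - xSeq f L x₀ i‖ ^ 2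

/-- The averaged solution `ȳ_k = ∑_{i=0}^{k-1} p_{k,i} y_i`. -/
def yBar (f : E → ℝ) (L : ℝ) (x₀ : E) (k : ℕ) : E :=
  ∑ i ∈ Finset.range k, weight k i • ySeq f L x₀ i

/-- First quotient in the update of `M_k`. -/
def trapezoidQuotient (f : E → ℝ) (L : ℝ) (x₀ : E) (k : ℕ) : ℝ :=
  let x := xSeq f L x₀ k
  let y := ySeq f L x₀ k
  12 * (f y - f x - 1 / 2 * inner ℝ (gradient f y + gradient f x) (y - x)) / ‖y - x‖ ^ 3

/-- Second quotient in the update of `M_k` (used for `k ≥ 1`). -/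
def interpolationQuotient (f : E → ℝ) (L : ℝ) (x₀ : E) (k : ℕ) : ℝ :=
  let x := xSeq f L x₀ k
  let xPrev := xSeq f L x₀ (k - 1)
  let y := ySeq f L x₀ k
  ‖gradient f y + theta k • gradient f xPrev - (1 + theta k) • gradient f x‖
    / (theta k * ‖x - xPrev‖ ^ 2)

/-- Third quotient, of the extended update of `M_k` (used for `k ≥ 1`). -/
def averageQuotient (f : E → ℝ) (L : ℝ) (x₀ : E) (k : ℕ) : ℝ :=
  let x := xSeq f L x₀ k
  let xPrev := xSeq f L x₀ (k - 1)
  16 * (Z k ^ 2 * ‖gradient f (yBar f L x₀ k)‖ - Z k * L * ‖x - xPrev‖)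
    / (((k : ℝ) - 1) * ((k : ℝ) + 5) ^ 2 * S f L x₀ k)

/-- The two update rules for the estimate `M_k`: without and with the quotient that involves the
gradient at the averaged solution. -/
inductive MRule
  | basic
  | extended

/-- The estimate `M_k` in an epoch, starting from `M₀`. In each quotient the numerator vanishes
whenever the denominator does; such an expression `0/0` has the value `0` in Lean, so it does not
influence the maximum, because `M_{k-1} ≥ M₀ > 0`. -/
def MEst (rule : MRule) (f : E → ℝ) (M₀ L : ℝ) (x₀ : E) : ℕ → ℝ
  | 0 => M₀
  | k + 1 =>
    let M := max (MEst rule f M₀ L x₀ k)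
      (max (trapezoidQuotient f L x₀ (k + 1)) (interpolationQuotient f L x₀ (k + 1)))
    match rule with
    | .basic => M
    | .extended => max M (averageQuotient f L x₀ (k + 1))

end Epoch

/-- The state of the algorithm between two iterations: the starting point of the current epoch,
the current estimate `L`, and the iteration counter `k` of the epoch. The points
`x_i, y_i` (`i ≤ k`) and the estimates `M_i` of the epoch are determined by these data. -/
structure State (E : Type*) where
  x₀ : E
  L : ℝ
  k : ℕ

section Algorithm

variable {E : Type*} [NormedAddCommGroup E] [InnerProductSpace ℝ E] [CompleteSpace E]

open Classical in
/-- One iteration of the algorithm, including a possible restart at its end. -/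
def step (rule : MRule) (f : E → ℝ) (M₀ α β : ℝ) (s : State E) : State E :=
  let k := s.k + 1
  if f (xSeq f s.L s.x₀ k) > f s.x₀ - s.L * S f s.L s.x₀ k / (2 * ((k : ℝ) + 1)) then
    ⟨xSeq f s.L s.x₀ (k - 1), α * s.L, 0⟩
  else if ((k : ℝ) + 1) ^ 5 * MEst rule f M₀ s.L s.x₀ k ^ 2 * S f s.L s.x₀ k > s.L ^ 2 then
    ⟨xSeq f s.L s.x₀ k, β * s.L, 0⟩
  else
    ⟨s.x₀, s.L, k⟩

/-- The state after `K` iterations in total. -/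
def state (rule : MRule) (f : E → ℝ) (Linit M₀ α β : ℝ) (xinit : E) : ℕ → State E
  | 0 => ⟨xinit, Linit, 0⟩
  | K + 1 => step rule f M₀ α β (state rule f Linit M₀ α β xinit K)

/-- The averaged solution `ȳ_k` at the total iteration `K ≥ 1` (before a possible restart at the
end of that iteration). -/
def averaged (rule : MRule) (f : E → ℝ) (Linit M₀ α β : ℝ) (xinit : E) (K : ℕ) : E :=
  let s := state rule f Linit M₀ α β xinit (K - 1)
  yBar f s.L s.x₀ (s.k + 1)

end Algorithm

end RestartedAGD

end

noncomputable section

namespace RestartedAGD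

/-! ### Taylor-type estimates under Lipschitz gradient and Hessian -/

section Smooth

variable {E : Type*} [NormedAddCommGroup E] [InnerProductSpace ℝ E] [CompleteSpace E]

/-! The proof plays two lower bounds on S_k against each other.

Gradient side: since θ_k = k/(k+1), the weighted sum of the gradients at the y_i telescopes. Up to a
Jensen error of order M k S_k, the gradient at ȳ_k therefore has norm 2L/(k+1) · ‖x_k - x_{k-1}‖
(`norm_gradient_yBar_le`). If all these gradients exceed ε while (k+1)^5 M_k² S_k ≤ L², then S_k is
at least of order ε² k³/L² (`lower_bound_S`), and k itself is O(ε^(-1/4)) (`epoch_length_le`).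

Descent side: a potential made of f(x_{k+1}), the last step and the gradient at x_k decreases as
long as the condition on M_k holds. Hence the decrease test cannot fail once L ≥ L_f
(`sufficient_decrease`), and L never exceeds L̄.

An epoch ended by the second test lowers f by at least L S/(2(k+1)), where S is bounded below both
by order ε² k³/L² and by L²/((k+1)^5 M²). Weighted geometric means of these bounds give a decrease
of order ε^(7/4) per iteration (`length_le_of_decrease`) and of order ε^(3/2) per epoch
(`le_decrease`). The total decrease Δ thus limits both the iterations in such epochs and their
number. An epoch ended by the first test multiplies L by α; since L ≤ L̄, the number of these is
logarithmic plus log_α(1/β) for each decrease of L, and each lasts O(ε^(-1/4)) iterations.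

Both final bounds come from `iteration_bound`, with a factor ρ such that ρ M_k can replace M_f in
the gradient estimate: ρ = M̄/M₀ for either rule, ρ = 1 for the extended rule. -/

lemma hasDerivAt_comp_line {f : E → ℝ} (hf : Differentiable ℝ f) (x v : E) (t : ℝ) :
    HasDerivAt (fun s : ℝ => f (x + s • v)) (inner ℝ (gradient f (x + t • v)) v) t := by
  have h1 : HasDerivAt (fun s : ℝ => x + s • v) v t := by
    simpa using ((hasDerivAt_id t).smul_const v).const_add x
  have h2 := (hf (x + t • v)).hasGradientAt.hasFDerivAt
  exact (h2.comp_hasDerivAt t h1).congr_deriv (InnerProductSpace.toDual_apply_apply ..)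

lemma hasDerivAt_gradient_line {f : E → ℝ} (hf : Differentiable ℝ (gradient f)) (x v : E) (t : ℝ) :
    HasDerivAt (fun s : ℝ => gradient f (x + s • v))
      (fderiv ℝ (gradient f) (x + t • v) v) t := by
  have h1 : HasDerivAt (fun s : ℝ => x + s • v) v t := by
    simpa using ((hasDerivAt_id t).smul_const v).const_add x
  exact (hf (x + t • v)).hasFDerivAt.comp_hasDerivAt t h1

lemma norm_gradient_taylor_le {f : E → ℝ} {M : ℝ} (hg : Differentiable ℝ (gradient f))
    (hM : ∀ x y, ‖fderiv ℝ (gradient f) x - fderiv ℝ (gradient f) y‖ ≤ M * ‖x - y‖) (x y : E) :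
    ‖gradient f y - gradient f x - fderiv ℝ (gradient f) x (y - x)‖ ≤ M / 2 * ‖y - x‖ ^ 2 := by
  set v := y - x with hv
  have hd : ∀ t : ℝ, HasDerivAt
      (fun s : ℝ => gradient f (x + s • v) - gradient f x - s • fderiv ℝ (gradient f) x v)
      (fderiv ℝ (gradient f) (x + t • v) v - fderiv ℝ (gradient f) x v) t := by
    intro t
    have h := ((hasDerivAt_gradient_line hg x v t).sub_const (gradient f x)).sub
      ((hasDerivAt_id t).smul_const (fderiv ℝ (gradient f) x v))
    exact h.congr_deriv (by simp)
  have hB : ∀ t : ℝ, HasDerivAt (fun s : ℝ => M / 2 * ‖v‖ ^ 2 * s ^ 2) (M * ‖v‖ ^ 2 * t) t := by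
    intro t
    have := (hasDerivAt_pow 2 t).const_mul (M / 2 * ‖v‖ ^ 2)
    exact this.congr_deriv (by norm_num; ring)
  have key := image_norm_le_of_norm_deriv_right_le_deriv_boundary
    (f := fun s : ℝ => gradient f (x + s • v) - gradient f x - s • fderiv ℝ (gradient f) x v)
    (a := 0) (b := 1) (fun t _ => (hd t).continuousAt.continuousWithinAt)
    (fun t _ => (hd t).hasDerivWithinAt) (B := fun s : ℝ => M / 2 * ‖v‖ ^ 2 * s ^ 2)
    (by simp) hB ?_ (Set.right_mem_Icc.2 zero_le_one)
  · simpa [hv] using key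
  · intro t ht
    rw [← _root_.sub_apply]
    refine (ContinuousLinearMap.le_opNorm _ _).trans ?_
    refine (mul_le_mul_of_nonneg_right (hM _ _) (norm_nonneg _)).trans ?_
    rw [add_sub_cancel_left, norm_smul, Real.norm_of_nonneg ht.1]
    exact le_of_eq (by ring)

lemma descent_lemma {f : E → ℝ} {L : ℝ} (hf : Differentiable ℝ f)
    (hL : ∀ x y, ‖gradient f x - gradient f y‖ ≤ L * ‖x - y‖) (x v : E) :
    f (x + v) ≤ f x + inner ℝ (gradient f x) v + L / 2 * ‖v‖ ^ 2 := by
  have hd : ∀ t : ℝ, HasDerivAt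
      (fun s : ℝ => f (x + s • v) - s * inner ℝ (gradient f x) v - L / 2 * ‖v‖ ^ 2 * s ^ 2)
      (inner ℝ (gradient f (x + t • v)) v - inner ℝ (gradient f x) v - L * ‖v‖ ^ 2 * t) t := by
    intro t
    have h := ((hasDerivAt_comp_line hf x v t).sub
      ((hasDerivAt_id t).mul_const (inner ℝ (gradient f x) v))).sub
      ((hasDerivAt_pow 2 t).const_mul (L / 2 * ‖v‖ ^ 2))
    exact h.congr_deriv (by simp only [Nat.cast_ofNat, Nat.add_one_sub_one]; ring)
  have hanti := antitoneOn_of_deriv_nonpos (convex_Icc (0 : ℝ) 1)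
    (fun t _ => (hd t).continuousAt.continuousWithinAt)
    (fun t _ => (hd t).differentiableAt.differentiableWithinAt) ?_
  · have := hanti (Set.left_mem_Icc.2 zero_le_one) (Set.right_mem_Icc.2 zero_le_one) zero_le_one
    simp only [one_smul, zero_smul, add_zero] at this
    linarith
  · intro t ht
    rw [interior_Icc] at ht
    rw [(hd t).deriv, ← inner_sub_left]
    have h1 := real_inner_le_norm (gradient f (x + t • v) - gradient f x) v
    have h2 := hL (x + t • v) x
    rw [add_sub_cancel_left, norm_smul, Real.norm_of_nonneg ht.1.le] at h2
    nlinarith [norm_nonneg v, mul_le_mul_of_nonneg_right h2 (norm_nonneg v)]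

/-- Along the segment, the derivative of the trapezoid error is half the inner product of v with a
gradient Taylor remainder expanded at the moving point x + t v. It is at most M t² ‖v‖³/4, which
integrates to the constant 1/12. -/
lemma trapezoid_error_le {f : E → ℝ} {M : ℝ} (hf : Differentiable ℝ f)
    (hg : Differentiable ℝ (gradient f))
    (hM : ∀ x y, ‖fderiv ℝ (gradient f) x - fderiv ℝ (gradient f) y‖ ≤ M * ‖x - y‖) (x y : E) :
    f y - f x - 1 / 2 * inner ℝ (gradient f y + gradient f x) (y - x) ≤ M / 12 * ‖y - x‖ ^ 3 := by
  set v := y - x with hv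
  have hd : ∀ t : ℝ, HasDerivAt
      (fun s : ℝ => f (x + s • v)
        - s / 2 * (inner ℝ (gradient f (x + s • v)) v + inner ℝ (gradient f x) v)
        - M / 12 * ‖v‖ ^ 3 * s ^ 3)
      (1 / 2 * (inner ℝ (gradient f (x + t • v)) v - inner ℝ (gradient f x) v
        - t * inner ℝ (fderiv ℝ (gradient f) (x + t • v) v) v) - M / 4 * ‖v‖ ^ 3 * t ^ 2) t := by
    intro t
    have h0 : HasDerivAt (fun s : ℝ => (inner ℝ (gradient f (x + s • v)) v : ℝ))
        (inner ℝ (fderiv ℝ (gradient f) (x + t • v) v) v) t := by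
      simpa using (hasDerivAt_gradient_line hg x v t).inner ℝ (hasDerivAt_const t v)
    have h := ((hasDerivAt_comp_line hf x v t).sub
      (((hasDerivAt_id t).div_const 2).mul (h0.add_const (inner ℝ (gradient f x) v)))).sub
      ((hasDerivAt_pow 3 t).const_mul (M / 12 * ‖v‖ ^ 3))
    exact h.congr_deriv (by simp only [id, Nat.cast_ofNat, Nat.add_one_sub_one]; ring)
  have hanti := antitoneOn_of_deriv_nonpos (convex_Icc (0 : ℝ) 1)
    (fun t _ => (hd t).continuousAt.continuousWithinAt)
    (fun t _ => (hd t).differentiableAt.differentiableWithinAt) ?_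
  · have := hanti (Set.left_mem_Icc.2 zero_le_one) (Set.right_mem_Icc.2 zero_le_one) zero_le_one
    simp only [one_smul, zero_smul, add_zero, show x + v = y by rw [hv]; abel] at this
    rw [inner_add_left]
    linarith
  · intro t ht
    rw [interior_Icc] at ht
    rw [(hd t).deriv]
    have h1 := norm_gradient_taylor_le hg hM (x + t • v) x
    have h2 : x - (x + t • v) = -(t • v) := by abel
    rw [h2, norm_neg, norm_smul, Real.norm_of_nonneg ht.1.le, map_neg, map_smul] at h1
    have h3 := real_inner_le_norm (-(gradient f x - gradient f (x + t • v)
      - -(t • fderiv ℝ (gradient f) (x + t • v) v))) v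
    rw [norm_neg] at h3
    have h4 := h3.trans (mul_le_mul_of_nonneg_right h1 (norm_nonneg v))
    simp only [inner_neg_left, inner_sub_left, real_inner_smul_left] at h4
    nlinarith [h4]

/-- Jensen-type inequality for the gradient; the spread may be measured from any point. -/
lemma norm_gradient_jensen_le {f : E → ℝ} {M : ℝ} (hM0 : 0 ≤ M) (hg : Differentiable ℝ (gradient f))
    (hM : ∀ x y, ‖fderiv ℝ (gradient f) x - fderiv ℝ (gradient f) y‖ ≤ M * ‖x - y‖)
    {ι : Type*} (s : Finset ι) (p : ι → ℝ) (hp : ∀ i ∈ s, 0 ≤ p i) (hp1 : ∑ i ∈ s, p i = 1)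
    (z : ι → E) (c : E) :
    ‖gradient f (∑ i ∈ s, p i • z i) - ∑ i ∈ s, p i • gradient f (z i)‖
      ≤ M / 2 * ∑ i ∈ s, p i * ‖z i - c‖ ^ 2 := by
  set w := ∑ i ∈ s, p i • z i with hw
  have hzero : ∑ i ∈ s, p i • (z i - w) = 0 := by
    simp only [smul_sub, Finset.sum_sub_distrib, ← Finset.sum_smul, hp1, one_smul, ← hw, sub_self]
  -- The weighted spread is smallest around the mean w.
  have hvar : ∑ i ∈ s, p i * ‖z i - w‖ ^ 2 ≤ ∑ i ∈ s, p i * ‖z i - c‖ ^ 2 := by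
    have h : ∀ i ∈ s, p i * ‖z i - c‖ ^ 2
        = p i * ‖z i - w‖ ^ 2 + 2 * inner ℝ (p i • (z i - w)) (w - c) + p i * ‖w - c‖ ^ 2 := by
      intro i _
      have : z i - c = (z i - w) + (w - c) := by abel
      rw [this, norm_add_sq_real, real_inner_smul_left]; ring
    rw [Finset.sum_congr rfl h, Finset.sum_add_distrib, Finset.sum_add_distrib, ← Finset.mul_sum,
      ← sum_inner, hzero, inner_zero_left, ← Finset.sum_mul, hp1]
    nlinarith [sq_nonneg ‖w - c‖]
  have heq : ∑ i ∈ s, p i • gradient f (z i) - gradient f w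
      = ∑ i ∈ s, p i • (gradient f (z i) - gradient f w - fderiv ℝ (gradient f) w (z i - w)) := by
    simp only [smul_sub, Finset.sum_sub_distrib, ← Finset.sum_smul, hp1, one_smul]
    have : ∑ i ∈ s, p i • fderiv ℝ (gradient f) w (z i - w) = 0 := by
      simp only [← map_smul, ← map_sum, hzero, map_zero]
    rw [this, sub_zero]
  rw [norm_sub_rev, heq]
  refine (norm_sum_le _ _).trans ?_
  refine le_trans ?_ (mul_le_mul_of_nonneg_left hvar (by positivity))
  rw [Finset.mul_sum]
  refine Finset.sum_le_sum fun i hi => ?_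
  rw [norm_smul, Real.norm_of_nonneg (hp i hi)]
  nlinarith [mul_le_mul_of_nonneg_left (norm_gradient_taylor_le hg hM w (z i)) (hp i hi)]

end Smooth

/-! ### Closed forms of the averaging weights -/

lemma theta_zero : theta 0 = 0 := by simp [theta]

lemma theta_nonneg (k : ℕ) : 0 ≤ theta k := by unfold theta; positivity

lemma theta_succ_pos (k : ℕ) : 0 < theta (k + 1) := by unfold theta; positivity

lemma theta_le_one (k : ℕ) : theta k ≤ 1 := by
  unfold theta
  rw [div_le_one (by positivity)]
  linarith

lemma prod_theta {i k : ℕ} (h : i < k) :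
    ∏ j ∈ Finset.Ico (i + 1) k, theta j = ((i : ℝ) + 1) / k := by
  induction k, h using Nat.le_induction with
  | base => simp [div_self (show ((i : ℝ) + 1) ≠ 0 by positivity)]
  | succ n hn ih =>
    have hn' : (n : ℝ) ≠ 0 := by
      have : 0 < n := by omega
      positivity
    rw [Finset.prod_Ico_succ_top hn, ih, theta]
    push_cast
    field_simp

lemma sum_range_add_one (n : ℕ) :
    ∑ i ∈ Finset.range n, ((i : ℝ) + 1) = (n : ℝ) * (n + 1) / 2 := by
  induction n with
  | zero => simp
  | succ n ih => rw [Finset.sum_range_succ, ih]; push_cast; ring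

lemma Z_succ (k : ℕ) : Z (k + 1) = ((k : ℝ) + 2) / 2 := by
  have h : ∀ i ∈ Finset.range (k + 1), ∏ j ∈ Finset.Ico (i + 1) (k + 1), theta j
      = ((i : ℝ) + 1) / ((k + 1 : ℕ) : ℝ) := fun i hi => prod_theta (Finset.mem_range.1 hi)
  rw [Z, Finset.sum_congr rfl h, ← Finset.sum_div, sum_range_add_one]
  push_cast
  field_simp
  ring

lemma weight_succ {i k : ℕ} (h : i < k + 1) :
    weight (k + 1) i = 2 / (((k : ℝ) + 1) * (k + 2)) * ((i : ℝ) + 1) := by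
  rw [weight, Z_succ, prod_theta h]
  push_cast
  field_simp

/-! ### The iterates and the gradient at the averaged solution -/

section Sequences

variable {E : Type*} [NormedAddCommGroup E] [InnerProductSpace ℝ E] [CompleteSpace E]
  (f : E → ℝ) (L : ℝ) (x₀ : E)

lemma xSeq_succ (k : ℕ) : xSeq f L x₀ (k + 1)
    = ySeq f L x₀ k - (1 / L) • gradient f (ySeq f L x₀ k) := rfl

lemma ySeq_succ (k : ℕ) : ySeq f L x₀ (k + 1)
    = xSeq f L x₀ (k + 1) + theta (k + 1) • (xSeq f L x₀ (k + 1) - xSeq f L x₀ k) := rfl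

lemma ySeq_eq (k : ℕ) : ySeq f L x₀ k
    = xSeq f L x₀ k + theta k • (xSeq f L x₀ k - xSeq f L x₀ (k - 1)) := by
  cases k with
  | zero => rw [theta_zero, zero_smul, add_zero]; rfl
  | succ k => exact ySeq_succ f L x₀ k

variable {L} in
lemma gradient_ySeq (hL : L ≠ 0) (k : ℕ) : gradient f (ySeq f L x₀ k)
    = L • (theta k • (xSeq f L x₀ k - xSeq f L x₀ (k - 1))
      - (xSeq f L x₀ (k + 1) - xSeq f L x₀ k)) := by
  have h : theta k • (xSeq f L x₀ k - xSeq f L x₀ (k - 1))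
      - (xSeq f L x₀ (k + 1) - xSeq f L x₀ k) = (1 / L) • gradient f (ySeq f L x₀ k) := by
    have hy : theta k • (xSeq f L x₀ k - xSeq f L x₀ (k - 1)) = ySeq f L x₀ k - xSeq f L x₀ k := by
      rw [eq_sub_iff_add_eq', ← ySeq_eq]
    rw [xSeq_succ, hy]
    abel
  rw [h, smul_smul, mul_one_div_cancel hL, one_smul]

lemma S_succ (k : ℕ) : S f L x₀ (k + 1)
    = S f L x₀ k + ‖xSeq f L x₀ (k + 1) - xSeq f L x₀ k‖ ^ 2 := Finset.sum_range_succ _ _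

lemma S_nonneg (k : ℕ) : 0 ≤ S f L x₀ k := Finset.sum_nonneg fun _ _ => sq_nonneg _

lemma S_mono : Monotone (S f L x₀) :=
  monotone_nat_of_le_succ fun k => by
    rw [S_succ]
    nlinarith [sq_nonneg ‖xSeq f L x₀ (k + 1) - xSeq f L x₀ k‖]

variable {L} in
-- Telescopes because (k+1) θ_k = k: each gradient is L times a difference of consecutive steps, and
-- the weight i+1 turns it into an exact difference. This is why the averaging weights are
-- proportional to i+1.
lemma sum_gradient_ySeq (hL : L ≠ 0) (k : ℕ) :
    ∑ i ∈ Finset.range k, ((i : ℝ) + 1) • gradient f (ySeq f L x₀ i)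
      = -((L * k) • (xSeq f L x₀ k - xSeq f L x₀ (k - 1))) := by
  induction k with
  | zero => simp
  | succ k ih =>
    have h1 : ((k : ℝ) + 1) * theta k = k := by unfold theta; field_simp
    have h2 (a b : E) : ((k : ℝ) + 1) • L • (theta k • a - b) = (L * k) • a - (L * (k + 1)) • b := by
      have h3 : ((k : ℝ) + 1) • L • (theta k • a - b)
          = (L * (((k : ℝ) + 1) * theta k)) • a - (L * (k + 1)) • b := by module
      rw [h3, h1]
    rw [Finset.sum_range_succ, ih, gradient_ySeq f x₀ hL, Nat.add_sub_cancel, h2]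
    push_cast
    abel

/-- The path from x_k back to x_i, extended by the extrapolation at y_i, uses at most k+1-i steps;
Cauchy–Schwarz does the rest. For i = 0 there is no extrapolation, in agreement with the truncated
`i - 1`. -/
lemma norm_ySeq_sub_xSeq_sq_le {i k : ℕ} (h : i ≤ k) :
    ‖ySeq f L x₀ i - xSeq f L x₀ k‖ ^ 2 ≤ ((k : ℝ) + 1 - i) * S f L x₀ (k + 1) := by
  set δ : ℕ → ℝ := fun l => ‖xSeq f L x₀ (l + 1) - xSeq f L x₀ l‖ with hδ
  have hx : ‖xSeq f L x₀ i - xSeq f L x₀ k‖ ≤ ∑ l ∈ Finset.Ico i k, δ l := by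
    rw [norm_sub_rev, ← Finset.sum_Ico_sub _ h]
    exact norm_sum_le _ _
  have hy : ‖ySeq f L x₀ i - xSeq f L x₀ k‖ ≤ ∑ l ∈ Finset.Ico (i - 1) k, δ l := by
    cases i with
    | zero => exact hx
    | succ i =>
      rw [Nat.add_sub_cancel, Finset.sum_eq_sum_Ico_succ_bot (by omega), ySeq_succ,
        add_sub_right_comm, add_comm (δ i)]
      refine (norm_add_le _ _).trans (add_le_add hx ?_)
      rw [norm_smul, Real.norm_of_nonneg (theta_nonneg _)]
      exact mul_le_of_le_one_left (norm_nonneg _) (theta_le_one _)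
  have hcs := sq_sum_le_card_mul_sum_sq (s := Finset.Ico (i - 1) k) (f := δ)
  have hsub : ∑ l ∈ Finset.Ico (i - 1) k, δ l ^ 2 ≤ S f L x₀ (k + 1) :=
    Finset.sum_le_sum_of_subset_of_nonneg
      (fun l hl => by simp only [Finset.mem_Ico] at hl; simp only [Finset.mem_range]; omega)
      fun _ _ _ => sq_nonneg _
  have hcard : ((Finset.Ico (i - 1) k).card : ℝ) ≤ (k : ℝ) + 1 - i := by
    rw [Nat.card_Ico, le_sub_iff_add_le]
    exact_mod_cast (by omega : k - (i - 1) + i ≤ k + 1)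
  calc ‖ySeq f L x₀ i - xSeq f L x₀ k‖ ^ 2 ≤ (∑ l ∈ Finset.Ico (i - 1) k, δ l) ^ 2 :=
        pow_le_pow_left₀ (norm_nonneg _) hy 2
    _ ≤ _ := hcs
    _ ≤ _ := mul_le_mul hcard hsub (Finset.sum_nonneg fun _ _ => sq_nonneg _)
        ((Nat.cast_nonneg _).trans hcard)

lemma sum_mul_sub (c : ℝ) (m : ℕ) : ∑ i ∈ Finset.range m, ((i : ℝ) + 1) * (c - i)
    = c * (m * (m + 1) / 2) - ((m : ℝ) - 1) * m * (m + 1) / 3 := by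
  induction m with
  | zero => simp
  | succ m ih => rw [Finset.sum_range_succ, ih]; push_cast; ring

/-- The coefficient of `M S_k` in the bound of the gradient at the averaged solution, for
`k = j + 1`. -/
def spreadCoeff (j : ℕ) : ℝ := j * ((j : ℝ) + 6) ^ 2 / (4 * ((j : ℝ) + 2) ^ 2)

lemma spreadCoeff_nonneg (j : ℕ) : 0 ≤ spreadCoeff j := by unfold spreadCoeff; positivity

/-- The computation gives the coefficient (k+3)/3. The larger `2 * spreadCoeff k` is used because it
matches the denominator of the extended quotient; it vanishes at k = 0, where the spread is zero as
well. -/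
lemma sum_weight_mul_norm_sq_le (k : ℕ) :
    ∑ i ∈ Finset.range (k + 1), weight (k + 1) i * ‖ySeq f L x₀ i - xSeq f L x₀ k‖ ^ 2
      ≤ 2 * spreadCoeff k * S f L x₀ (k + 1) := by
  rcases Nat.eq_zero_or_pos k with rfl | hk
  · have : ySeq f L x₀ 0 - xSeq f L x₀ 0 = 0 := sub_self _
    simp [this, spreadCoeff]
  have hS := S_nonneg f L x₀ (k + 1)
  have h1 : ∀ i ∈ Finset.range (k + 1), weight (k + 1) i * ‖ySeq f L x₀ i - xSeq f L x₀ k‖ ^ 2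
      ≤ 2 / (((k : ℝ) + 1) * (k + 2)) * S f L x₀ (k + 1) * (((i : ℝ) + 1) * ((k : ℝ) + 1 - i)) := by
    intro i hi
    have hi' := Finset.mem_range.1 hi
    rw [weight_succ hi']
    have := mul_le_mul_of_nonneg_left (norm_ySeq_sub_xSeq_sq_le f L x₀ (Nat.lt_succ_iff.1 hi'))
      (show 0 ≤ 2 / (((k : ℝ) + 1) * (k + 2)) * ((i : ℝ) + 1) by positivity)
    linarith
  refine (Finset.sum_le_sum h1).trans ?_
  rw [← Finset.mul_sum, sum_mul_sub, mul_right_comm]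
  refine mul_le_mul_of_nonneg_right ?_ hS
  have hk' : (1 : ℝ) ≤ k := by exact_mod_cast hk
  rw [spreadCoeff]
  push_cast
  have e : 2 / (((k : ℝ) + 1) * (k + 2)) * (((k : ℝ) + 1) * (((k : ℝ) + 1) * (k + 1 + 1) / 2)
      - ((k : ℝ) + 1 - 1) * (k + 1) * (k + 1 + 1) / 3) = ((k : ℝ) + 3) / 3 := by
    field_simp
    ring
  rw [e, mul_div_assoc', div_le_div_iff₀ (by positivity) (by positivity), ← sub_nonneg]
  obtain ⟨t, ht⟩ : ∃ t : ℝ, (k : ℝ) = 1 + t := ⟨k - 1, by ring⟩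
  have ht0 : 0 ≤ t := by linarith
  rw [ht]
  ring_nf
  positivity

variable {f L} in
-- Jensen around x_k compares the gradient at the average with the average of the gradients, and the
-- latter telescopes to one step.
theorem norm_gradient_yBar_le {M : ℝ} (hL : 0 < L) (hM0 : 0 ≤ M) (hg : Differentiable ℝ (gradient f))
    (hM : ∀ x y, ‖fderiv ℝ (gradient f) x - fderiv ℝ (gradient f) y‖ ≤ M * ‖x - y‖) (k : ℕ) :
    ‖gradient f (yBar f L x₀ (k + 1))‖
      ≤ 2 * L / ((k : ℝ) + 2) * ‖xSeq f L x₀ (k + 1) - xSeq f L x₀ k‖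
        + M * spreadCoeff k * S f L x₀ (k + 1) := by
  have hw : ∀ i ∈ Finset.range (k + 1), 0 ≤ weight (k + 1) i := fun i hi => by
    rw [weight_succ (Finset.mem_range.1 hi)]; positivity
  have hw1 : ∑ i ∈ Finset.range (k + 1), weight (k + 1) i = 1 := by
    rw [Finset.sum_congr rfl fun i hi => weight_succ (Finset.mem_range.1 hi), ← Finset.mul_sum,
      sum_range_add_one]
    push_cast
    field_simp
    ring
  have h1 := norm_gradient_jensen_le hM0 hg hM _ _ hw hw1 (ySeq f L x₀) (xSeq f L x₀ k)
  have h2 := sum_weight_mul_norm_sq_le f L x₀ k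
  have h3 : ∑ i ∈ Finset.range (k + 1), weight (k + 1) i • gradient f (ySeq f L x₀ i)
      = -((2 * L / ((k : ℝ) + 2)) • (xSeq f L x₀ (k + 1) - xSeq f L x₀ k)) := by
    rw [Finset.sum_congr rfl fun i hi => by rw [weight_succ (Finset.mem_range.1 hi), ← smul_smul],
      ← Finset.smul_sum, sum_gradient_ySeq f x₀ hL.ne', smul_neg, smul_smul, Nat.add_sub_cancel]
    congr 2
    push_cast
    field_simp
  have h4 := norm_le_norm_add_norm_sub
    (∑ i ∈ Finset.range (k + 1), weight (k + 1) i • gradient f (ySeq f L x₀ i))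
    (gradient f (yBar f L x₀ (k + 1)))
  rw [h3, norm_neg, norm_smul, Real.norm_of_nonneg (by positivity), ← h3,
    norm_sub_rev _ (gradient f (yBar f L x₀ (k + 1)))] at h4
  have h5 := mul_le_mul_of_nonneg_left h2 (show 0 ≤ M / 2 by linarith)
  unfold yBar at h4 ⊢
  linarith

/-! ### The estimate M_k: what it guarantees, and its upper bound -/

lemma le_MEst_succ (rule : MRule) (M₀ : ℝ) (k : ℕ) :
    max (MEst rule f M₀ L x₀ k)
      (max (trapezoidQuotient f L x₀ (k + 1)) (interpolationQuotient f L x₀ (k + 1)))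
      ≤ MEst rule f M₀ L x₀ (k + 1) := by
  cases rule
  · exact le_refl _
  · exact le_max_left _ _

lemma MEst_mono (rule : MRule) (M₀ : ℝ) : Monotone (MEst rule f M₀ L x₀) :=
  monotone_nat_of_le_succ fun k => (le_max_left _ _).trans (le_MEst_succ f L x₀ rule M₀ k)

lemma le_MEst (rule : MRule) (M₀ : ℝ) (k : ℕ) : M₀ ≤ MEst rule f M₀ L x₀ k :=
  MEst_mono f L x₀ rule M₀ (Nat.zero_le k)

lemma ySeq_sub_xSeq (k : ℕ) : ySeq f L x₀ (k + 1) - xSeq f L x₀ (k + 1)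
    = theta (k + 1) • (xSeq f L x₀ (k + 1) - xSeq f L x₀ k) := by
  rw [ySeq_succ, add_sub_cancel_left]

/-- The quotient with its denominator cleared; when y = x the inequality is trivial, so the value of
0/0 is harmless. -/
lemma trapezoid_MEst (rule : MRule) (M₀ : ℝ) (k : ℕ) :
    f (ySeq f L x₀ (k + 1)) - f (xSeq f L x₀ (k + 1))
      - 1 / 2 * inner ℝ (gradient f (ySeq f L x₀ (k + 1)) + gradient f (xSeq f L x₀ (k + 1)))
        (theta (k + 1) • (xSeq f L x₀ (k + 1) - xSeq f L x₀ k))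
      ≤ MEst rule f M₀ L x₀ (k + 1) / 12
        * (theta (k + 1) * ‖xSeq f L x₀ (k + 1) - xSeq f L x₀ k‖) ^ 3 := by
  have h := ((le_max_left _ _).trans (le_max_right _ _)).trans (le_MEst_succ f L x₀ rule M₀ k)
  have hyx := ySeq_sub_xSeq f L x₀ k
  rw [← Real.norm_of_nonneg (theta_nonneg (k + 1)), ← norm_smul,
    Real.norm_of_nonneg (theta_nonneg (k + 1)), ← hyx]
  rcases eq_or_ne (ySeq f L x₀ (k + 1)) (xSeq f L x₀ (k + 1)) with h0 | h0
  · simp [h0]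
  · have hpos : 0 < ‖ySeq f L x₀ (k + 1) - xSeq f L x₀ (k + 1)‖ ^ 3 :=
      pow_pos (norm_pos_iff.2 (sub_ne_zero.2 h0)) 3
    simp only [trapezoidQuotient] at h
    rw [div_le_iff₀ hpos] at h
    linarith

lemma interpolation_MEst (rule : MRule) (M₀ : ℝ) (k : ℕ) :
    ‖gradient f (ySeq f L x₀ (k + 1)) + theta (k + 1) • gradient f (xSeq f L x₀ k)
      - (1 + theta (k + 1)) • gradient f (xSeq f L x₀ (k + 1))‖
      ≤ MEst rule f M₀ L x₀ (k + 1)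
        * (theta (k + 1) * ‖xSeq f L x₀ (k + 1) - xSeq f L x₀ k‖ ^ 2) := by
  have h := ((le_max_right _ _).trans (le_max_right _ _)).trans (le_MEst_succ f L x₀ rule M₀ k)
  rcases eq_or_ne (xSeq f L x₀ (k + 1)) (xSeq f L x₀ k) with h0 | h0
  · have hy : ySeq f L x₀ (k + 1) = xSeq f L x₀ (k + 1) := by
      rw [ySeq_succ, h0, sub_self, smul_zero, add_zero]
    rw [hy, h0, add_smul, one_smul, sub_self, sub_self, norm_zero]
    simp
  · have hpos : 0 < theta (k + 1) * ‖xSeq f L x₀ (k + 1) - xSeq f L x₀ k‖ ^ 2 :=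
      mul_pos (theta_succ_pos k) (pow_pos (norm_pos_iff.2 (sub_ne_zero.2 h0)) 2)
    simp only [interpolationQuotient, Nat.add_sub_cancel] at h
    rwa [div_le_iff₀ hpos] at h

variable {f L} in
lemma trapezoidQuotient_le {M : ℝ} (hf : Differentiable ℝ f) (hM0 : 0 ≤ M)
    (hg : Differentiable ℝ (gradient f))
    (hM : ∀ x y, ‖fderiv ℝ (gradient f) x - fderiv ℝ (gradient f) y‖ ≤ M * ‖x - y‖) (k : ℕ) :
    trapezoidQuotient f L x₀ k ≤ M := by
  refine div_le_of_le_mul₀ (by positivity) hM0 ?_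
  have := trapezoid_error_le hf hg hM (xSeq f L x₀ k) (ySeq f L x₀ k)
  linarith

variable {f L} in
-- x_k is the convex combination of y_k and x_{k-1} with weights 1/(1+θ) and θ/(1+θ), so this is the
-- Jensen estimate for two points, centred at x_k.
lemma interpolationQuotient_le {M : ℝ} (hM0 : 0 ≤ M) (hg : Differentiable ℝ (gradient f))
    (hM : ∀ x y, ‖fderiv ℝ (gradient f) x - fderiv ℝ (gradient f) y‖ ≤ M * ‖x - y‖) (k : ℕ) :
    interpolationQuotient f L x₀ k ≤ M := by
  have hθ := theta_nonneg k
  have hθ1 := theta_le_one k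
  refine div_le_of_le_mul₀ (by positivity) hM0 ?_
  set θ := theta k with hθdef
  set x := xSeq f L x₀ k
  set z := xSeq f L x₀ (k - 1)
  have hy : ySeq f L x₀ k = x + θ • (x - z) := ySeq_eq f L x₀ k
  set y := ySeq f L x₀ k
  have hpos : 0 < 1 + θ := by linarith
  have h := norm_gradient_jensen_le hM0 hg hM Finset.univ ![1 / (1 + θ), θ / (1 + θ)]
    (by intro i _; fin_cases i <;> simp <;> positivity)
    (by simp; field_simp) ![y, z] x
  have hx : (1 / (1 + θ)) • y + (θ / (1 + θ)) • z = x := by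
    have : (1 / (1 + θ)) • y + (θ / (1 + θ)) • z = ((1 / (1 + θ)) * (1 + θ)) • x := by
      rw [hy]; module
    rw [this, one_div_mul_cancel hpos.ne', one_smul]
  simp only [Fin.sum_univ_two, Matrix.cons_val_zero, Matrix.cons_val_one] at h
  rw [hx, show y - x = θ • (x - z) by rw [hy]; abel, norm_smul, Real.norm_of_nonneg hθ,
    norm_sub_rev z x] at h
  have hv : gradient f y + θ • gradient f z - (1 + θ) • gradient f x
      = -((1 + θ) • (gradient f x
        - ((1 / (1 + θ)) • gradient f y + (θ / (1 + θ)) • gradient f z))) := by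
    rw [smul_sub, smul_add, smul_smul, smul_smul, mul_one_div_cancel hpos.ne',
      mul_div_cancel₀ _ hpos.ne', one_smul]
    abel
  rw [hv, norm_neg, norm_smul, Real.norm_of_nonneg hpos.le]
  refine (mul_le_mul_of_nonneg_left h hpos.le).trans ?_
  have : (1 + θ) * (M / 2 * (1 / (1 + θ) * (θ * ‖x - z‖) ^ 2 + θ / (1 + θ) * ‖x - z‖ ^ 2))
      = M * θ * ‖x - z‖ ^ 2 * ((1 + θ) / 2) := by
    field_simp
    ring
  rw [this]
  have h0 : 0 ≤ M * θ * ‖x - z‖ ^ 2 := by positivity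
  nlinarith

variable {f L} in
-- The extended quotient is the bound `norm_gradient_yBar_le` solved for M, so it cannot exceed a
-- Hessian Lipschitz constant.
lemma averageQuotient_le {M : ℝ} (hL : 0 < L) (hM0 : 0 ≤ M) (hg : Differentiable ℝ (gradient f))
    (hM : ∀ x y, ‖fderiv ℝ (gradient f) x - fderiv ℝ (gradient f) y‖ ≤ M * ‖x - y‖) (k : ℕ) :
    averageQuotient f L x₀ (k + 1) ≤ M := by
  have hS := S_nonneg f L x₀ (k + 1)
  simp only [averageQuotient, Z_succ, Nat.add_sub_cancel]
  push_cast
  rw [add_sub_cancel_right]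
  refine div_le_of_le_mul₀ (by positivity) hM0 ?_
  have h := norm_gradient_yBar_le x₀ hL hM0 hg hM k
  rw [spreadCoeff] at h
  have h' := mul_le_mul_of_nonneg_left h (show (0 : ℝ) ≤ 16 * (((k : ℝ) + 2) / 2) ^ 2 by positivity)
  have e : 16 * (((k : ℝ) + 2) / 2) ^ 2 * (2 * L / ((k : ℝ) + 2)
        * ‖xSeq f L x₀ (k + 1) - xSeq f L x₀ k‖
        + M * (k * ((k : ℝ) + 6) ^ 2 / (4 * ((k : ℝ) + 2) ^ 2)) * S f L x₀ (k + 1))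
      = 16 * (((k : ℝ) + 2) / 2 * L * ‖xSeq f L x₀ (k + 1) - xSeq f L x₀ k‖)
        + M * (k * ((k : ℝ) + 6) ^ 2 * S f L x₀ (k + 1)) := by
    field_simp
    ring
  rw [e] at h'
  rw [show (k : ℝ) + 1 + 5 = k + 6 by ring]
  linarith

variable {f L} in
lemma MEst_le {M M₀ : ℝ} (rule : MRule) (hf : Differentiable ℝ f) (hL : 0 < L) (hM0 : 0 ≤ M)
    (hg : Differentiable ℝ (gradient f))
    (hM : ∀ x y, ‖fderiv ℝ (gradient f) x - fderiv ℝ (gradient f) y‖ ≤ M * ‖x - y‖) (k : ℕ) :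
    MEst rule f M₀ L x₀ k ≤ max M₀ M := by
  induction k with
  | zero => exact le_max_left _ _
  | succ k ih =>
    have h1 := (trapezoidQuotient_le (L := L) x₀ hf hM0 hg hM (k + 1)).trans (le_max_right M₀ M)
    have h2 := (interpolationQuotient_le (L := L) x₀ hM0 hg hM (k + 1)).trans (le_max_right M₀ M)
    have h3 := (averageQuotient_le x₀ hL hM0 hg hM k).trans (le_max_right M₀ M)
    cases rule
    · exact max_le ih (max_le h1 h2)
    · exact max_le (max_le ih (max_le h1 h2)) h3

variable {f L} in
/-- With the extended rule, the estimate `M_k` itself bounds the gradient at the averaged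
solution. -/
lemma norm_gradient_yBar_le_MEst {M M₀ : ℝ} (hL : 0 < L) (hM0 : 0 ≤ M)
    (hg : Differentiable ℝ (gradient f))
    (hM : ∀ x y, ‖fderiv ℝ (gradient f) x - fderiv ℝ (gradient f) y‖ ≤ M * ‖x - y‖) (k : ℕ) :
    ‖gradient f (yBar f L x₀ (k + 1))‖
      ≤ 2 * L / ((k : ℝ) + 2) * ‖xSeq f L x₀ (k + 1) - xSeq f L x₀ k‖
        + MEst .extended f M₀ L x₀ (k + 1) * spreadCoeff k * S f L x₀ (k + 1) := by
  have h := norm_gradient_yBar_le x₀ hL hM0 hg hM k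
  have hpos := mul_nonneg (spreadCoeff_nonneg k) (S_nonneg f L x₀ (k + 1))
  -- If the denominator of the quotient vanishes, so does the Jensen error, and the bound with the
  -- true constant has no M-term left.
  rcases hpos.eq_or_lt with h0 | h0
  · rw [mul_assoc, ← h0] at h ⊢
    simpa using h
  have hq : averageQuotient f L x₀ (k + 1) ≤ MEst .extended f M₀ L x₀ (k + 1) := le_max_right _ _
  have e : ((k : ℝ) * ((k : ℝ) + 6) ^ 2 * S f L x₀ (k + 1))
      = 4 * ((k : ℝ) + 2) ^ 2 * (spreadCoeff k * S f L x₀ (k + 1)) := by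
    rw [spreadCoeff]; field_simp
  simp only [averageQuotient, Z_succ, Nat.add_sub_cancel] at hq
  push_cast at hq
  rw [add_sub_cancel_right, show (k : ℝ) + 1 + 5 = k + 6 by ring, e,
    div_le_iff₀ (by positivity)] at hq
  have h2 : (0 : ℝ) < ((k : ℝ) + 2) ^ 2 := by positivity
  refine le_of_mul_le_mul_left ?_ (show (0 : ℝ) < 4 * ((k : ℝ) + 2) ^ 2 by positivity)
  have e2 : 4 * ((k : ℝ) + 2) ^ 2 * (2 * L / ((k : ℝ) + 2)
        * ‖xSeq f L x₀ (k + 1) - xSeq f L x₀ k‖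
        + MEst .extended f M₀ L x₀ (k + 1) * spreadCoeff k * S f L x₀ (k + 1))
      = 8 * ((k : ℝ) + 2) * L * ‖xSeq f L x₀ (k + 1) - xSeq f L x₀ k‖
        + MEst .extended f M₀ L x₀ (k + 1) * (4 * ((k : ℝ) + 2) ^ 2
          * (spreadCoeff k * S f L x₀ (k + 1))) := by
    field_simp
    ring
  rw [e2]
  linarith

end Sequences

/-! ### Algebra of the potential -/

section Potential

variable {E : Type*} [NormedAddCommGroup E] [InnerProductSpace ℝ E]

/-- One-step estimate for the potential, with function values and gradients divided by `L`. -/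
lemma potential_step {F F' θ m : ℝ} {d g G p : E} (hθ : 0 < θ)
    (hF : F' ≤ F - 1 / 2 * ‖g‖ ^ 2 + 1 / 2 * inner ℝ (g + G) (θ • d)
      + m / 12 * θ ^ 3 * ‖d‖ ^ 2)
    (he : ‖g + θ • p - (1 + θ) • G‖ ≤ m * θ * ‖d‖) :
    F' + 1 / 2 * ‖θ • d - g‖ ^ 2 + θ / 2 * inner ℝ G (θ • d - g) + θ / 8 * ‖G‖ ^ 2
      ≤ F + θ ^ 2 / 2 * ‖d‖ ^ 2 + θ ^ 2 / 2 * inner ℝ p d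
        + m * (θ ^ 2 / 2 + θ ^ 3 / 12) * ‖d‖ ^ 2
        + θ ^ 3 / (2 * (3 + 4 * θ)) * (‖p‖ + m * ‖d‖) ^ 2 := by
  -- Substituting for g through e removes the gradient at y from the cross terms; the ‖g‖² terms of
  -- the descent and of ‖θ d - g‖² cancel.
  set e := g + θ • p - (1 + θ) • G with hedef
  have hed : -inner ℝ e d ≤ m * θ * ‖d‖ * ‖d‖ := by
    rw [← inner_neg_left]
    refine (real_inner_le_norm _ _).trans ?_
    rw [norm_neg]
    exact mul_le_mul_of_nonneg_right he (norm_nonneg _)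
  have heG : -inner ℝ e G ≤ m * θ * ‖d‖ * ‖G‖ := by
    rw [← inner_neg_left]
    refine (real_inner_le_norm _ _).trans ?_
    rw [norm_neg]
    exact mul_le_mul_of_nonneg_right he (norm_nonneg _)
  have hpG := real_inner_le_norm p G
  have ed : inner ℝ e d = inner ℝ g d + θ * inner ℝ p d - (1 + θ) * inner ℝ G d := by
    rw [hedef, inner_sub_left, inner_add_left, real_inner_smul_left, real_inner_smul_left]
  have eG : inner ℝ e G = inner ℝ g G + θ * inner ℝ p G - (1 + θ) * ‖G‖ ^ 2 := by
    rw [hedef, inner_sub_left, inner_add_left, real_inner_smul_left, real_inner_smul_left,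
      real_inner_self_eq_norm_sq]
  rw [norm_sub_sq_real, norm_smul, Real.norm_of_nonneg hθ.le, inner_sub_right,
    real_inner_smul_right, real_inner_smul_left, real_inner_comm g G, real_inner_comm g d]
  rw [real_inner_smul_right, inner_add_left] at hF
  -- The ‖G‖² terms add up to θ/8 - θ(1+θ)/2 = -θ(3+4θ)/8; completing the square in ‖G‖ gives the
  -- denominator 3+4θ.
  have hsq : θ ^ 2 / 2 * ‖G‖ * (‖p‖ + m * ‖d‖) - θ * (3 + 4 * θ) / 8 * ‖G‖ ^ 2
      ≤ θ ^ 3 / (2 * (3 + 4 * θ)) * (‖p‖ + m * ‖d‖) ^ 2 := by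
    have : θ ^ 3 / (2 * (3 + 4 * θ)) * (‖p‖ + m * ‖d‖) ^ 2
        - (θ ^ 2 / 2 * ‖G‖ * (‖p‖ + m * ‖d‖) - θ * (3 + 4 * θ) / 8 * ‖G‖ ^ 2)
        = θ / (8 * (3 + 4 * θ)) * ((3 + 4 * θ) * ‖G‖ - 2 * θ * (‖p‖ + m * ‖d‖)) ^ 2 := by
      field_simp
      ring
    have : 0 ≤ θ / (8 * (3 + 4 * θ)) * ((3 + 4 * θ) * ‖G‖ - 2 * θ * (‖p‖ + m * ‖d‖)) ^ 2 := by
      positivity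
    linarith
  have h1 := mul_le_mul_of_nonneg_left hed (show 0 ≤ θ / 2 by linarith)
  have h2 := mul_le_mul_of_nonneg_left heG (show 0 ≤ θ / 2 by linarith)
  have h3 := mul_le_mul_of_nonneg_left hpG (show 0 ≤ θ ^ 2 / 2 by positivity)
  rw [ed] at h1
  rw [eG] at h2
  linarith

/-- With n = k+2, the right side of `potential_step` is compared with the previous potential as a
quadratic form in P = ‖p‖ and D = ‖d‖. The restart condition makes m of order n^(-5/2), so the
m-terms fit into a slack of order n^(-2). -/
lemma potential_coeff_le {n m P D q : ℝ} (hn : 3 ≤ n) (hm : 0 ≤ m) (hmn : m ^ 2 * n ^ 5 ≤ 1)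
    (hP : 0 ≤ P) (hD : 0 ≤ D) (hq : |q| ≤ P * D) :
    ((n - 1) / n) ^ 2 / 2 * D ^ 2 + ((n - 1) / n) ^ 2 / 2 * q
      + m * (((n - 1) / n) ^ 2 / 2 + ((n - 1) / n) ^ 3 / 12) * D ^ 2
      + ((n - 1) / n) ^ 3 / (2 * (3 + 4 * ((n - 1) / n))) * (P + m * D) ^ 2
    ≤ 1 / 2 * D ^ 2 + (n - 2) / (n - 1) / 2 * q + (n - 2) / (n - 1) / 8 * P ^ 2
      - D ^ 2 / (2 * (n + 1)) := by
  have hn0 : 0 < n := by linarith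
  have hn1 : 0 < n - 1 := by linarith
  have hPD : 0 ≤ P * D := mul_nonneg hP hD
  have hmn2 : m * n ^ 2 ≤ 3 / 5 := by
    refine (sq_le_sq₀ (by positivity) (by norm_num)).1 ?_
    have : m ^ 2 * n ^ 4 * 3 ≤ m ^ 2 * n ^ 5 := by
      rw [pow_succ n 4, ← mul_assoc]
      exact mul_le_mul_of_nonneg_left hn (by positivity)
    nlinarith
  have hm1 : m ≤ 1 / 15 := by nlinarith [mul_le_mul_of_nonneg_left (show (9 : ℝ) ≤ n ^ 2 by nlinarith) hm]
  set θ := (n - 1) / n with hθ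
  have hθ0 : 0 < θ := by positivity
  have hθ1 : θ ≤ 1 := by rw [hθ, div_le_one hn0]; linarith
  set c := θ ^ 3 / (2 * (3 + 4 * θ)) with hc
  have hc0 : 0 ≤ c := by positivity
  have hc1 : c ≤ 1 / 14 := by
    rw [hc, div_le_div_iff₀ (by positivity) (by norm_num)]
    nlinarith [pow_le_one₀ hθ0.le hθ1 (n := 2), pow_le_one₀ hθ0.le hθ1 (n := 3), pow_pos hθ0 2]
  have hs : c + 1 / 32 ≤ (n - 2) / (n - 1) / 8 := by
    have h7 : 0 < 7 * n - 4 := by linarith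
    have h1 : c = (n - 1) ^ 3 / (2 * n ^ 2 * (7 * n - 4)) := by
      have : 3 + 4 * θ = (7 * n - 4) / n := by rw [hθ]; field_simp; ring
      rw [hc, this, hθ]
      field_simp
    have h2 : (n - 2) / (n - 1) / 8 - 1 / 32 = (3 * n - 7) / (32 * (n - 1)) := by
      field_simp; ring
    rw [← le_sub_iff_add_le, h2, h1, div_le_div_iff₀ (by positivity) (by positivity), ← sub_nonneg]
    obtain ⟨t, rfl⟩ : ∃ t : ℝ, n = 3 + t := ⟨n - 3, by ring⟩
    have ht0 : 0 ≤ t := by linarith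
    ring_nf
    positivity
  have hr : (θ ^ 2 / 2 - (n - 2) / (n - 1) / 2) * q ≤ (n - 2) / (2 * n ^ 2) * (P * D) := by
    have h1 : θ ^ 2 / 2 - (n - 2) / (n - 1) / 2 = -((n ^ 2 - 3 * n + 1) / (2 * n ^ 2 * (n - 1))) := by
      rw [hθ]; field_simp; ring
    have h2 : 0 ≤ (n ^ 2 - 3 * n + 1) / (2 * n ^ 2 * (n - 1)) :=
      div_nonneg (by nlinarith) (by positivity)
    have h3 : (n ^ 2 - 3 * n + 1) / (2 * n ^ 2 * (n - 1)) ≤ (n - 2) / (2 * n ^ 2) := by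
      rw [div_le_div_iff₀ (by positivity) (by positivity)]
      nlinarith [pow_pos hn0 2]
    rw [h1]
    calc -((n ^ 2 - 3 * n + 1) / (2 * n ^ 2 * (n - 1))) * q
        ≤ (n ^ 2 - 3 * n + 1) / (2 * n ^ 2 * (n - 1)) * (P * D) := by
          rw [neg_mul_comm]
          exact mul_le_mul_of_nonneg_left ((neg_le_abs q).trans hq) h2
      _ ≤ _ := mul_le_mul_of_nonneg_right h3 hPD
  -- w dominates the whole coefficient of P D. Splitting w P D ≤ w D² + w P²/4 with w ≤ 1/8 uses the
  -- reserve P²/32 kept in `hs`.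
  set w := (n - 1) / (2 * n ^ 2) with hw
  have hw0 : 0 ≤ w := by positivity
  have hw1 : w ≤ 1 / 8 := by
    rw [hw, div_le_div_iff₀ (by positivity) (by norm_num)]
    nlinarith [sq_nonneg (n - 2)]
  have hcross : (n - 2) / (2 * n ^ 2) + m / 7 ≤ w := by
    rw [hw, div_add' _ _ _ (by positivity), div_le_div_iff_of_pos_right (by positivity)]
    nlinarith
  -- The slack is exactly 1/(2n(n+1)). The m-terms need at most 5m/8 ≤ 3/(8n²), which fits precisely
  -- from n = 3 on.
  have hdiag : θ ^ 2 / 2 + m * (7 / 12) + m ^ 2 / 14 + 1 / (2 * (n + 1)) + w ≤ 1 / 2 := by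
    have h1 : 1 / 2 - θ ^ 2 / 2 - 1 / (2 * (n + 1)) - w = 1 / (2 * n * (n + 1)) := by
      rw [hθ, hw]; field_simp; ring
    have h2 : m ≤ 3 / 5 / n ^ 2 := by rwa [le_div_iff₀ (by positivity)]
    have h3 : 3 / 8 / n ^ 2 ≤ 1 / (2 * n * (n + 1)) := by
      rw [div_le_div_iff₀ (by positivity) (by positivity)]
      nlinarith
    have h4 : 3 / 8 / n ^ 2 = 5 / 8 * (3 / 5 / n ^ 2) := by ring
    nlinarith
  have hmθ : m * (θ ^ 2 / 2 + θ ^ 3 / 12) ≤ m * (7 / 12) :=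
    mul_le_mul_of_nonneg_left (by
      nlinarith [pow_le_one₀ hθ0.le hθ1 (n := 2), pow_le_one₀ hθ0.le hθ1 (n := 3)]) hm
  have k1 := mul_le_mul_of_nonneg_right hdiag (sq_nonneg D)
  have k2 := mul_le_mul_of_nonneg_right hcross hPD
  have k3 := mul_le_mul_of_nonneg_right hs (sq_nonneg P)
  have k4 := mul_le_mul_of_nonneg_right hmθ (sq_nonneg D)
  have k5 : c * (2 * (P * D) * m) ≤ 1 / 14 * (2 * (P * D) * m) :=
    mul_le_mul_of_nonneg_right hc1 (by positivity)
  have k6 : c * (m ^ 2 * D ^ 2) ≤ 1 / 14 * (m ^ 2 * D ^ 2) :=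
    mul_le_mul_of_nonneg_right hc1 (by positivity)
  have k7 : w * (P * D) ≤ w * D ^ 2 + 1 / 32 * P ^ 2 := by
    nlinarith [mul_nonneg hw0 (sq_nonneg (D - P / 2)), mul_le_mul_of_nonneg_right hw1 (sq_nonneg P)]
  have e1 : D ^ 2 / (2 * (n + 1)) = 1 / (2 * (n + 1)) * D ^ 2 := by ring
  have e2 : c * (P + m * D) ^ 2 = c * P ^ 2 + c * (2 * (P * D) * m) + c * (m ^ 2 * D ^ 2) := by ring
  rw [e1, e2]
  linarith

end Potential

/-! ### Sufficient decrease within an epoch -/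

section Descent

variable {E : Type*} [NormedAddCommGroup E] [InnerProductSpace ℝ E] [CompleteSpace E]
  (f : E → ℝ) (L : ℝ) (x₀ : E)

/-- The potential at the iterate `x_{k+1}`, divided by `L`. -/
def potential (k : ℕ) : ℝ :=
  f (xSeq f L x₀ (k + 1)) / L + 1 / 2 * ‖xSeq f L x₀ (k + 1) - xSeq f L x₀ k‖ ^ 2
    + theta k / 2 * inner ℝ ((1 / L) • gradient f (xSeq f L x₀ k))
      (xSeq f L x₀ (k + 1) - xSeq f L x₀ k)
    + theta k / 8 * ‖(1 / L) • gradient f (xSeq f L x₀ k)‖ ^ 2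

lemma xSeq_succ_sub (k : ℕ) : xSeq f L x₀ (k + 2) - xSeq f L x₀ (k + 1)
    = theta (k + 1) • (xSeq f L x₀ (k + 1) - xSeq f L x₀ k)
      - (1 / L) • gradient f (ySeq f L x₀ (k + 1)) := by
  rw [xSeq_succ f L x₀ (k + 1), ← ySeq_sub_xSeq]
  abel

variable {f L} in
lemma descent_ySeq {Lf : ℝ} (hL : 0 < L) (hLf : Lf ≤ L) (hf : Differentiable ℝ f)
    (hlip : ∀ x y, ‖gradient f x - gradient f y‖ ≤ Lf * ‖x - y‖) (k : ℕ) :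
    f (xSeq f L x₀ (k + 1)) / L ≤ f (ySeq f L x₀ k) / L
      - 1 / 2 * ‖(1 / L) • gradient f (ySeq f L x₀ k)‖ ^ 2 := by
  have h := descent_lemma (L := L) hf
    (fun x y => (hlip x y).trans (mul_le_mul_of_nonneg_right hLf (norm_nonneg _)))
    (ySeq f L x₀ k) (-((1 / L) • gradient f (ySeq f L x₀ k)))
  rw [← sub_eq_add_neg, ← xSeq_succ, inner_neg_right, real_inner_smul_right,
    real_inner_self_eq_norm_sq, norm_neg] at h
  rw [div_le_iff₀ hL]
  refine h.trans (le_of_eq ?_)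
  rw [norm_smul, Real.norm_of_nonneg (by positivity)]
  field_simp
  ring

variable {f L} in
-- Uses the scaled quantity m = M_k ‖d‖/L; since ‖d‖² ≤ S_k, the restart condition becomes m²
-- (k+2)^5 ≤ 1.
lemma potential_succ_le {Lf M₀ : ℝ} (rule : MRule) (hL : 0 < L) (hLf : Lf ≤ L) (hM₀ : 0 < M₀)
    (hf : Differentiable ℝ f)
    (hlip : ∀ x y, ‖gradient f x - gradient f y‖ ≤ Lf * ‖x - y‖) (k : ℕ)
    (hk : ((k : ℝ) + 2) ^ 5 * MEst rule f M₀ L x₀ (k + 1) ^ 2 * S f L x₀ (k + 1) ≤ L ^ 2) :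
    potential f L x₀ (k + 1) ≤ potential f L x₀ k
      - ‖xSeq f L x₀ (k + 1) - xSeq f L x₀ k‖ ^ 2 / (2 * ((k : ℝ) + 3)) := by
  have hM := hM₀.trans_le (le_MEst f L x₀ rule M₀ (k + 1))
  have hT := trapezoid_MEst f L x₀ rule M₀ k
  have hI := interpolation_MEst f L x₀ rule M₀ k
  set M := MEst rule f M₀ L x₀ (k + 1)
  set d := xSeq f L x₀ (k + 1) - xSeq f L x₀ k with hd
  set m := M * ‖d‖ / L with hm
  have hm0 : 0 ≤ m := by positivity
  have hmn : m ^ 2 * ((k : ℝ) + 2) ^ 5 ≤ 1 := by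
    have h1 : ‖d‖ ^ 2 ≤ S f L x₀ (k + 1) := by
      rw [S_succ]; linarith [S_nonneg f L x₀ k]
    have h2 := mul_le_mul_of_nonneg_left h1 (show 0 ≤ ((k : ℝ) + 2) ^ 5 * M ^ 2 by positivity)
    rw [hm, div_pow, div_mul_eq_mul_div, div_le_one (by positivity)]
    linarith
  have hD := descent_ySeq x₀ hL hLf hf hlip (k + 1)
  have hstep := potential_step (F := f (xSeq f L x₀ (k + 1)) / L)
    (F' := f (xSeq f L x₀ (k + 2)) / L) (θ := theta (k + 1)) (m := m) (d := d)
    (g := (1 / L) • gradient f (ySeq f L x₀ (k + 1)))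
    (G := (1 / L) • gradient f (xSeq f L x₀ (k + 1)))
    (p := (1 / L) • gradient f (xSeq f L x₀ k)) (theta_succ_pos k) ?_ ?_
  · rw [hd, ← xSeq_succ_sub, ← hd] at hstep
    have hθ : theta (k + 1) = ((k : ℝ) + 2 - 1) / ((k : ℝ) + 2) := by
      rw [theta]; push_cast; ring
    have key : theta (k + 1) ^ 2 / 2 * ‖d‖ ^ 2
          + theta (k + 1) ^ 2 / 2 * inner ℝ ((1 / L) • gradient f (xSeq f L x₀ k)) d
          + m * (theta (k + 1) ^ 2 / 2 + theta (k + 1) ^ 3 / 12) * ‖d‖ ^ 2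
          + theta (k + 1) ^ 3 / (2 * (3 + 4 * theta (k + 1)))
            * (‖(1 / L) • gradient f (xSeq f L x₀ k)‖ + m * ‖d‖) ^ 2
        ≤ 1 / 2 * ‖d‖ ^ 2 + theta k / 2 * inner ℝ ((1 / L) • gradient f (xSeq f L x₀ k)) d
          + theta k / 8 * ‖(1 / L) • gradient f (xSeq f L x₀ k)‖ ^ 2
          - ‖d‖ ^ 2 / (2 * ((k : ℝ) + 3)) := by
      -- For k = 0 the coefficient θ_0 = 0 leaves no ‖p‖² term to absorb the cross terms, but then p
      -- = -d and everything is a multiple of ‖d‖².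
      rcases Nat.eq_zero_or_pos k with rfl | hk0
      · have hp : (1 / L) • gradient f (xSeq f L x₀ 0) = -d := by
          rw [hd, xSeq_succ, show ySeq f L x₀ 0 = xSeq f L x₀ 0 from rfl]
          abel
        rw [hp, inner_neg_left, real_inner_self_eq_norm_sq, norm_neg, theta_zero, hθ]
        norm_num at hmn ⊢
        have hm1 : m ≤ 1 / 5 := by nlinarith
        nlinarith [sq_nonneg ‖d‖, mul_le_mul_of_nonneg_right hm1 (sq_nonneg ‖d‖),
          mul_le_mul_of_nonneg_right (mul_le_mul hm1 hm1 hm0 (by norm_num)) (sq_nonneg ‖d‖)]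
      · have hk1 : (1 : ℝ) ≤ k := by exact_mod_cast hk0
        have h := potential_coeff_le (n := (k : ℝ) + 2) (by linarith) hm0 hmn
          (norm_nonneg ((1 / L) • gradient f (xSeq f L x₀ k))) (norm_nonneg d)
          (abs_real_inner_le_norm _ d)
        rw [← hθ, show ((k : ℝ) + 2 - 2) / ((k : ℝ) + 2 - 1) = theta k by rw [theta]; ring,
          show (k : ℝ) + 2 + 1 = k + 3 by ring] at h
        exact h
    simp only [potential]
    rw [show k + 1 + 1 = k + 2 from rfl, ← hd]
    linarith
  · rw [← smul_add, real_inner_smul_left]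
    have hT' := div_le_div_of_nonneg_right hT hL.le
    rw [sub_div, sub_div] at hT'
    have e1 : M / 12 * (theta (k + 1) * ‖d‖) ^ 3 / L = m / 12 * theta (k + 1) ^ 3 * ‖d‖ ^ 2 := by
      rw [hm]; ring
    have e2 (r : ℝ) : 1 / 2 * (1 / L * r) = 1 / 2 * r / L := by ring
    rw [e1] at hT'
    rw [e2]
    linarith
  · have hv : (1 / L) • gradient f (ySeq f L x₀ (k + 1))
          + theta (k + 1) • (1 / L) • gradient f (xSeq f L x₀ k)
          - (1 + theta (k + 1)) • (1 / L) • gradient f (xSeq f L x₀ (k + 1))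
        = (1 / L) • (gradient f (ySeq f L x₀ (k + 1)) + theta (k + 1) • gradient f (xSeq f L x₀ k)
          - (1 + theta (k + 1)) • gradient f (xSeq f L x₀ (k + 1))) := by module
    rw [hv, norm_smul, Real.norm_of_nonneg (by positivity)]
    refine (mul_le_mul_of_nonneg_left hI (by positivity)).trans (le_of_eq ?_)
    rw [hm]; ring

variable {f L} in
/-- If `L` is at least the Lipschitz constant of the gradient, then the decrease condition cannot
fail before the condition on `M_k`. -/
theorem sufficient_decrease {Lf M₀ : ℝ} (rule : MRule) (hL : 0 < L) (hLf : Lf ≤ L) (hM₀ : 0 < M₀)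
    (hf : Differentiable ℝ f)
    (hlip : ∀ x y, ‖gradient f x - gradient f y‖ ≤ Lf * ‖x - y‖) (k : ℕ)
    (hk : ∀ j < k,
      ((j : ℝ) + 2) ^ 5 * MEst rule f M₀ L x₀ (j + 1) ^ 2 * S f L x₀ (j + 1) ≤ L ^ 2) :
    f (xSeq f L x₀ (k + 1)) ≤ f x₀ - L * S f L x₀ (k + 1) / (2 * ((k : ℝ) + 2)) := by
  -- The potential drops sum to this term because 1/(2(k+2)) decreases in k, so older steps only
  -- lose weight.
  have hpot : potential f L x₀ k + S f L x₀ k / (2 * ((k : ℝ) + 2)) ≤ f x₀ / L := by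
    induction k with
    | zero =>
      have h := descent_ySeq x₀ hL hLf hf hlip 0
      have hx : xSeq f L x₀ 1 - xSeq f L x₀ 0 = -((1 / L) • gradient f (ySeq f L x₀ 0)) := by
        rw [xSeq_succ, show ySeq f L x₀ 0 = xSeq f L x₀ 0 from rfl]
        abel
      rw [show ySeq f L x₀ 0 = x₀ from rfl] at h hx
      simp only [potential, theta_zero, zero_add, hx, norm_neg, S, Finset.range_zero,
        Finset.sum_empty]
      linarith
    | succ k ih =>
      have h1 := ih fun j hj => hk j (by omega)
      have h2 := potential_succ_le x₀ rule hL hLf hM₀ hf hlip k (hk k (by omega))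
      have h3 : S f L x₀ k / (2 * ((k : ℝ) + 3)) ≤ S f L x₀ k / (2 * ((k : ℝ) + 2)) :=
        div_le_div_of_nonneg_left (S_nonneg ..) (by positivity) (by linarith)
      rw [S_succ, add_div]
      push_cast
      rw [show (k : ℝ) + 1 + 2 = k + 3 by ring]
      linarith
  have hθ2 : 1 / 2 - 1 / (2 * ((k : ℝ) + 2)) = theta (k + 1) / 2 := by
    rw [theta]; push_cast; field_simp; ring
  simp only [potential] at hpot
  set d := xSeq f L x₀ (k + 1) - xSeq f L x₀ k with hd
  set p := (1 / L) • gradient f (xSeq f L x₀ k)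
  have hin : -(‖p‖ * ‖d‖) ≤ inner ℝ p d := (abs_le.1 (abs_real_inner_le_norm p d)).1
  -- After the share of ‖d‖²/2 needed to pass to S_{k+1} is spent, the rest is at least θ_k/2 · (‖d‖
  -- - ‖p‖/2)²; hence the coefficient θ/8 in the potential.
  have hq : 0 ≤ theta (k + 1) / 2 * ‖d‖ ^ 2 + theta k / 2 * inner ℝ p d
      + theta k / 8 * ‖p‖ ^ 2 := by
    have h1 := mul_le_mul_of_nonneg_left hin (show 0 ≤ theta k / 2 by linarith [theta_nonneg k])
    have h2 : theta k ≤ theta (k + 1) := by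
      rw [theta, theta, div_le_div_iff₀ (by positivity) (by positivity)]
      push_cast
      linarith
    nlinarith [mul_nonneg (theta_nonneg k) (sq_nonneg (‖d‖ - ‖p‖ / 2)),
      mul_le_mul_of_nonneg_right h2 (sq_nonneg ‖d‖)]
  have hS : S f L x₀ (k + 1) / (2 * ((k : ℝ) + 2)) = S f L x₀ k / (2 * ((k : ℝ) + 2))
      + (1 / 2 - theta (k + 1) / 2) * ‖d‖ ^ 2 := by
    rw [S_succ, ← hθ2]; ring
  have hfin : f (xSeq f L x₀ (k + 1)) / L ≤ f x₀ / L - S f L x₀ (k + 1) / (2 * ((k : ℝ) + 2)) := by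
    rw [hS]; linarith
  rw [div_le_iff₀ hL] at hfin
  refine hfin.trans (le_of_eq ?_)
  field_simp

end Descent

/-! ### Interpolation between the two lower bounds on S -/

section Scalar

lemma sum_range_add_two_sq (k : ℕ) : ∑ j ∈ Finset.range k, ((j : ℝ) + 2) ^ 2
    = (2 * ((k : ℝ) + 1) ^ 3 + 3 * ((k : ℝ) + 1) ^ 2 + ((k : ℝ) + 1) - 6) / 6 := by
  induction k with
  | zero => norm_num
  | succ k ih => rw [Finset.sum_range_succ, ih]; push_cast; ring

lemma spreadCoeff_le (j : ℕ) : spreadCoeff j ≤ ((j : ℝ) + 2) / 2 := by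
  rw [spreadCoeff, div_le_div_iff₀ (by positivity) (by norm_num)]
  have hj : (0 : ℝ) ≤ j := Nat.cast_nonneg j
  nlinarith [mul_nonneg (sq_nonneg ((j : ℝ) - 2)) (show (0 : ℝ) ≤ (j : ℝ) + 4 by linarith)]

/-- Combination of the two lower bounds on `S`: decrease per iteration. -/
lemma length_le_of_decrease {ε n ρ L M S : ℝ} (hε : 0 < ε) (hn : 1 ≤ n) (hρ : 0 < ρ) (hL : 0 < L)
    (hM : 0 < M) (hS : 0 ≤ S) (hA : ε ^ 2 * n ^ 3 ≤ 16 * ρ ^ 2 * L ^ 2 * S)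
    (hB : L ^ 2 ≤ (n + 1) ^ 5 * M ^ 2 * S) :
    n ≤ 70 * (ρ ^ (7 / 4 : ℝ) * L ^ (1 / 2 : ℝ) * M ^ (1 / 4 : ℝ) / ε ^ (7 / 4 : ℝ))
      * (L * S / (2 * (n + 1))) := by
  have hn0 : 0 < n := by linarith
  have key : (n * ε ^ (7 / 4 : ℝ)) ^ 8 ≤ (70 * (ρ ^ (7 / 4 : ℝ) * L ^ (1 / 2 : ℝ)
      * M ^ (1 / 4 : ℝ)) * (L * S / (2 * (n + 1)))) ^ 8 := by
    have e1 : (ε ^ (7 / 4 : ℝ)) ^ 8 = ε ^ 14 := by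
      rw [← Real.rpow_natCast, ← Real.rpow_mul hε.le, ← Real.rpow_natCast]; norm_num
    have e2 : (ρ ^ (7 / 4 : ℝ)) ^ 8 = ρ ^ 14 := by
      rw [← Real.rpow_natCast, ← Real.rpow_mul hρ.le, ← Real.rpow_natCast]; norm_num
    have e3 : (L ^ (1 / 2 : ℝ)) ^ 8 = L ^ 4 := by
      rw [← Real.rpow_natCast, ← Real.rpow_mul hL.le, ← Real.rpow_natCast]; norm_num
    have e4 : (M ^ (1 / 4 : ℝ)) ^ 8 = M ^ 2 := by
      rw [← Real.rpow_natCast, ← Real.rpow_mul hM.le, ← Real.rpow_natCast]; norm_num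
    rw [mul_pow, e1, mul_pow, mul_pow, mul_pow, mul_pow, e2, e3, e4, div_pow, mul_pow, mul_pow,
      mul_div_assoc', le_div_iff₀ (by positivity)]
    have hA7 := pow_le_pow_left₀ (by positivity) hA 7
    -- Seven copies of `hA` and one of `hB` produce S^8 with the exponents of the claim.
    have h1 : (ε ^ 2 * n ^ 3) ^ 7 * L ^ 2
        ≤ (16 * ρ ^ 2 * L ^ 2 * S) ^ 7 * ((n + 1) ^ 5 * M ^ 2 * S) :=
      mul_le_mul hA7 hB (by positivity) (by positivity)
    have h2 : ε ^ 14 * n ^ 21 ≤ 2 ^ 28 * (ρ ^ 14 * L ^ 12 * M ^ 2 * S ^ 8) * (n + 1) ^ 5 :=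
      le_of_mul_le_mul_right (by linarith) (show 0 < L ^ 2 by positivity)
    have h3 : (n + 1) ^ 13 ≤ 2 ^ 13 * n ^ 13 := by
      rw [← mul_pow]; exact pow_le_pow_left₀ (by positivity) (by linarith) 13
    set X := ρ ^ 14 * L ^ 12 * M ^ 2 * S ^ 8
    have hX : 0 ≤ X := by positivity
    have h4 := mul_le_mul_of_nonneg_right h2 (show 0 ≤ 2 ^ 8 * (n + 1) ^ 8 by positivity)
    have h5 := mul_le_mul_of_nonneg_left h3 (show 0 ≤ 2 ^ 36 * X by positivity)
    -- The constant 70 is 2^(49/8) rounded up.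
    have h6 : (2 : ℝ) ^ 49 * X * n ^ 13 ≤ 70 ^ 8 * X * n ^ 13 := by
      have : (2 : ℝ) ^ 49 ≤ 70 ^ 8 := by norm_num
      gcongr
    refine le_of_mul_le_mul_right ?_ (show 0 < n ^ 13 by positivity)
    linarith
  have h := (pow_le_pow_iff_left₀ (by positivity) (by positivity) (by norm_num)).1 key
  rw [mul_div_assoc' 70, div_mul_eq_mul_div, le_div_iff₀ (by positivity)]
  exact h

/-- Combination of the two lower bounds on `S`: decrease per epoch. -/
lemma le_decrease {ε n ρ L M S : ℝ} (hε : 0 < ε) (hn : 1 ≤ n) (hρ : 0 < ρ) (hL : 0 < L)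
    (hM : 0 < M) (hS : 0 ≤ S) (hA : ε ^ 2 * n ^ 3 ≤ 16 * ρ ^ 2 * L ^ 2 * S)
    (hB : L ^ 2 ≤ (n + 1) ^ 5 * M ^ 2 * S) :
    ε ^ (3 / 2 : ℝ) / (2 ^ (25 / 4 : ℝ) * ρ ^ (3 / 2 : ℝ) * M ^ (1 / 2 : ℝ))
      ≤ L * S / (2 * (n + 1)) := by
  have hn0 : 0 < n := by linarith
  have key : (ε ^ (3 / 2 : ℝ)) ^ 4 ≤ (L * S / (2 * (n + 1))
      * (2 ^ (25 / 4 : ℝ) * ρ ^ (3 / 2 : ℝ) * M ^ (1 / 2 : ℝ))) ^ 4 := by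
    have e1 : (ε ^ (3 / 2 : ℝ)) ^ 4 = ε ^ 6 := by
      rw [← Real.rpow_natCast, ← Real.rpow_mul hε.le, ← Real.rpow_natCast]; norm_num
    have e2 : (ρ ^ (3 / 2 : ℝ)) ^ 4 = ρ ^ 6 := by
      rw [← Real.rpow_natCast, ← Real.rpow_mul hρ.le, ← Real.rpow_natCast]; norm_num
    have e3 : ((2 : ℝ) ^ (25 / 4 : ℝ)) ^ 4 = 2 ^ 25 := by
      rw [← Real.rpow_natCast, ← Real.rpow_mul (by norm_num), ← Real.rpow_natCast]; norm_num
    have e4 : (M ^ (1 / 2 : ℝ)) ^ 4 = M ^ 2 := by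
      rw [← Real.rpow_natCast, ← Real.rpow_mul hM.le, ← Real.rpow_natCast]; norm_num
    rw [e1, mul_pow, mul_pow, mul_pow, e2, e3, e4, div_pow, mul_pow, mul_pow,
      div_mul_eq_mul_div, le_div_iff₀ (by positivity)]
    have hA3 := pow_le_pow_left₀ (by positivity) hA 3
    -- Three copies of `hA` and one of `hB` produce S^4, and L cancels from the lower bound.
    have h1 : (ε ^ 2 * n ^ 3) ^ 3 * L ^ 2
        ≤ (16 * ρ ^ 2 * L ^ 2 * S) ^ 3 * ((n + 1) ^ 5 * M ^ 2 * S) :=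
      mul_le_mul hA3 hB (by positivity) (by positivity)
    have h2 : ε ^ 6 * n ^ 9 ≤ 2 ^ 12 * (ρ ^ 6 * L ^ 4 * M ^ 2 * S ^ 4) * (n + 1) ^ 5 :=
      le_of_mul_le_mul_right (by linarith) (show 0 < L ^ 2 by positivity)
    have h3 : (n + 1) ^ 9 ≤ 2 ^ 9 * n ^ 9 := by
      rw [← mul_pow]; exact pow_le_pow_left₀ (by positivity) (by linarith) 9
    set X := ρ ^ 6 * L ^ 4 * M ^ 2 * S ^ 4
    have hX : 0 ≤ X := by positivity
    have h4 := mul_le_mul_of_nonneg_right h2 (show 0 ≤ 2 ^ 4 * (n + 1) ^ 4 by positivity)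
    have h5 := mul_le_mul_of_nonneg_left h3 (show 0 ≤ 2 ^ 16 * X by positivity)
    refine le_of_mul_le_mul_right ?_ (show 0 < n ^ 9 by positivity)
    linarith
  rw [div_le_iff₀ (by positivity)]
  exact (pow_le_pow_iff_left₀ (by positivity) (by positivity) (by norm_num)).1 key

end Scalar

/-! ### Lower bound on S and length of an epoch -/

section Epoch

variable {E : Type*} [NormedAddCommGroup E] [InnerProductSpace ℝ E] [CompleteSpace E]
  {f : E → ℝ} {L M₀ ρ ε : ℝ} {x₀ : E} {rule : MRule}

/-- Lower bound on `S_k` while all averaged solutions have large gradient and the condition on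
`M_k` has not been violated. -/
lemma lower_bound_S (hL : 0 < L) (hM₀ : 0 < M₀) (hρ : 1 ≤ ρ) (hε : 0 < ε) {k : ℕ} (hk : 0 < k)
    (hbound : ∀ j, ‖gradient f (yBar f L x₀ (j + 1))‖
      ≤ 2 * L / ((j : ℝ) + 2) * ‖xSeq f L x₀ (j + 1) - xSeq f L x₀ j‖
        + ρ * MEst rule f M₀ L x₀ (j + 1) * spreadCoeff j * S f L x₀ (j + 1))
    (hgrad : ∀ j < k, ε < ‖gradient f (yBar f L x₀ (j + 1))‖)
    (hcond : ((k : ℝ) + 1) ^ 5 * MEst rule f M₀ L x₀ k ^ 2 * S f L x₀ k ≤ L ^ 2) :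
    ε ^ 2 * ((k : ℝ) + 1) ^ 3 ≤ 16 * ρ ^ 2 * L ^ 2 * S f L x₀ k := by
  have hk1 : (1 : ℝ) ≤ k := by exact_mod_cast hk
  have hM := hM₀.trans_le (le_MEst f L x₀ rule M₀ k)
  have hMmono := MEst_mono f L x₀ rule M₀
  have hSmono := S_mono f L x₀
  have hS0 := S_nonneg f L x₀ k
  have hSdef : S f L x₀ k
    = ∑ i ∈ Finset.range k, ‖xSeq f L x₀ (i + 1) - xSeq f L x₀ i‖ ^ 2 := rfl
  -- T bounds the Jensen error at every index up to k.
  set T := ρ * MEst rule f M₀ L x₀ k * (((k : ℝ) + 1) / 2) * S f L x₀ k with hT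
  have hj : ∀ j < k, ((j : ℝ) + 2) * (ε - T) ≤ 2 * L * ‖xSeq f L x₀ (j + 1) - xSeq f L x₀ j‖ := by
    intro j hjk
    have hjk' : (j : ℝ) + 1 ≤ k := by exact_mod_cast hjk
    have h1 : ρ * MEst rule f M₀ L x₀ (j + 1) * spreadCoeff j * S f L x₀ (j + 1) ≤ T := by
      have h2 : spreadCoeff j ≤ ((k : ℝ) + 1) / 2 := (spreadCoeff_le j).trans (by linarith)
      have := spreadCoeff_nonneg j
      have := S_nonneg f L x₀ (j + 1)
      have := hMmono (show j + 1 ≤ k from hjk)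
      have := hSmono (show j + 1 ≤ k from hjk)
      rw [hT]
      gcongr
    have h2 := (hgrad j hjk).trans_le (hbound j)
    have h3 : ε - T ≤ 2 * L * ‖xSeq f L x₀ (j + 1) - xSeq f L x₀ j‖ / ((j : ℝ) + 2) := by
      rw [← div_mul_eq_mul_div]; linarith
    rw [le_div_iff₀ (by positivity)] at h3
    linarith
  set M := MEst rule f M₀ L x₀ k
  set σ := S f L x₀ k
  set n : ℝ := (k : ℝ) + 1 with hn
  have hn0 : 0 < n := by linarith
  set s := √σ with hs
  set t := √n with ht
  have hs2 : s ^ 2 = σ := Real.sq_sqrt hS0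
  have ht2 : t ^ 2 = n := Real.sq_sqrt hn0.le
  have hs0 : 0 ≤ s := Real.sqrt_nonneg _
  have ht0 : 0 < t := Real.sqrt_pos.2 hn0
  have hMst : M * s * t ^ 5 ≤ L := by
    refine (sq_le_sq₀ (by positivity) hL.le).1 ?_
    have : (M * s * t ^ 5) ^ 2 = (t ^ 2) ^ 5 * M ^ 2 * s ^ 2 := by ring
    rw [this, ht2, hs2]
    exact hcond
  have hTt : T * t ^ 3 ≤ ρ / 2 * (L * s) := by
    have : T * t ^ 3 = ρ / 2 * ((M * s * t ^ 5) * s) := by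
      rw [hT, ← hs2, ← ht2]; ring
    rw [this]
    gcongr
  have hmain : ε * t ^ 3 ≤ 4 * ρ * L * s := by
    have hLs : 0 ≤ L * s := by positivity
    rcases le_total ε T with h | h
    · have := mul_le_mul_of_nonneg_right h (show 0 ≤ t ^ 3 by positivity)
      nlinarith
    · have hQ : (ε - T) ^ 2 * ∑ j ∈ Finset.range k, ((j : ℝ) + 2) ^ 2 ≤ 4 * L ^ 2 * σ := by
        rw [hSdef, Finset.mul_sum, Finset.mul_sum]
        refine Finset.sum_le_sum fun j hjk => ?_
        have := pow_le_pow_left₀ (mul_nonneg (by positivity) (sub_nonneg.2 h))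
          (hj j (Finset.mem_range.1 hjk)) 2
        linarith
      rw [sum_range_add_two_sq, ← hn] at hQ
      -- The constant 16/49, just below the limiting ratio 1/3, yields 7/2 in `h2`; with the 1/2
      -- from `hTt` this makes the 4 of `hmain`.
      have hQ2 : 16 / 49 * n ^ 3 ≤ (2 * n ^ 3 + 3 * n ^ 2 + n - 6) / 6 := by
        have : 2 ≤ n := by linarith
        nlinarith [pow_pos hn0 3]
      have h1 := mul_le_mul_of_nonneg_left hQ2 (sq_nonneg (ε - T))
      have h2 : (ε - T) * t ^ 3 ≤ 7 / 2 * L * s := by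
        refine (sq_le_sq₀ (mul_nonneg (sub_nonneg.2 h) (by positivity)) (by positivity)).1 ?_
        have e1 : ((ε - T) * t ^ 3) ^ 2 = (ε - T) ^ 2 * (t ^ 2) ^ 3 := by ring
        have e2 : (7 / 2 * L * s) ^ 2 = 49 / 4 * L ^ 2 * s ^ 2 := by ring
        rw [e1, e2, ht2, hs2]
        linarith
      nlinarith
  have := pow_le_pow_left₀ (by positivity) hmain 2
  have e1 : (ε * t ^ 3) ^ 2 = ε ^ 2 * (t ^ 2) ^ 3 := by ring
  have e2 : (4 * ρ * L * s) ^ 2 = 16 * ρ ^ 2 * L ^ 2 * s ^ 2 := by ring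
  rwa [e1, e2, ht2, hs2] at this

/-- Upper bound on the length of an epoch. -/
lemma epoch_length_le (hL : 0 < L) (hM₀ : 0 < M₀) (hρ : 1 ≤ ρ) (hε : 0 < ε) {k : ℕ} (hk : 0 < k)
    (hbound : ∀ j, ‖gradient f (yBar f L x₀ (j + 1))‖
      ≤ 2 * L / ((j : ℝ) + 2) * ‖xSeq f L x₀ (j + 1) - xSeq f L x₀ j‖
        + ρ * MEst rule f M₀ L x₀ (j + 1) * spreadCoeff j * S f L x₀ (j + 1))
    (hgrad : ∀ j < k, ε < ‖gradient f (yBar f L x₀ (j + 1))‖)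
    (hcond : ((k : ℝ) + 1) ^ 5 * MEst rule f M₀ L x₀ k ^ 2 * S f L x₀ k ≤ L ^ 2) :
    ((k : ℝ) + 1) ^ 4 ≤ 4 * ρ * L ^ 2 / (M₀ * ε) := by
  have hA := lower_bound_S hL hM₀ hρ hε hk hbound hgrad hcond
  have hMM := le_MEst f L x₀ rule M₀ k
  have hM := hM₀.trans_le hMM
  set M := MEst rule f M₀ L x₀ k
  set n : ℝ := (k : ℝ) + 1
  have hn0 : 0 < n := by positivity
  have h1 : n ^ 4 * (M * ε) ≤ 4 * ρ * L ^ 2 := by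
    refine (sq_le_sq₀ (by positivity) (by positivity)).1 ?_
    -- Chaining `hA` with `hcond` eliminates S.
    have h2 := mul_le_mul_of_nonneg_right hA (show 0 ≤ n ^ 5 * M ^ 2 by positivity)
    have h3 := mul_le_mul_of_nonneg_left hcond (show 0 ≤ 16 * ρ ^ 2 * L ^ 2 by positivity)
    linarith
  rw [le_div_iff₀ (by positivity)]
  refine le_trans ?_ h1
  gcongr

/-- At the iteration that triggers the restart the condition on M is no longer available, so the
bound is taken one index earlier and S is monotone. The index 0 is direct: ȳ_1 is the starting
point, with gradient norm L ‖x_1 - x_0‖. -/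
lemma lower_bound_S_succ (hL : 0 < L) (hM₀ : 0 < M₀) (hρ : 1 ≤ ρ) (hε : 0 < ε) {k : ℕ}
    (hbound : ∀ j, ‖gradient f (yBar f L x₀ (j + 1))‖
      ≤ 2 * L / ((j : ℝ) + 2) * ‖xSeq f L x₀ (j + 1) - xSeq f L x₀ j‖
        + ρ * MEst rule f M₀ L x₀ (j + 1) * spreadCoeff j * S f L x₀ (j + 1))
    (hgrad : ∀ j < k + 1, ε < ‖gradient f (yBar f L x₀ (j + 1))‖)
    (hcond : ((k : ℝ) + 1) ^ 5 * MEst rule f M₀ L x₀ k ^ 2 * S f L x₀ k ≤ L ^ 2) :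
    ε ^ 2 * ((k : ℝ) + 1) ^ 3 ≤ 16 * ρ ^ 2 * L ^ 2 * S f L x₀ (k + 1) := by
  rcases Nat.eq_zero_or_pos k with rfl | hk
  · have h := (hgrad 0 (by omega)).trans_le (hbound 0)
    have hs : spreadCoeff 0 = 0 := by simp [spreadCoeff]
    rw [hs] at h
    have h' : ε ≤ L * ‖xSeq f L x₀ 1 - xSeq f L x₀ 0‖ := by
      norm_num at h
      linarith
    have h2 := pow_le_pow_left₀ hε.le h' 2
    have hS : S f L x₀ (0 + 1) = ‖xSeq f L x₀ 1 - xSeq f L x₀ 0‖ ^ 2 := by simp [S]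
    rw [hS]
    have h3 : 1 ≤ ρ ^ 2 := one_le_pow₀ hρ
    have h4 : 0 ≤ L ^ 2 * ‖xSeq f L x₀ 1 - xSeq f L x₀ 0‖ ^ 2 := by positivity
    rw [mul_pow] at h2
    norm_num
    nlinarith
  · refine (lower_bound_S hL hM₀ hρ hε hk hbound (fun j hj => hgrad j (by omega)) hcond).trans ?_
    exact mul_le_mul_of_nonneg_left (S_mono f L x₀ (Nat.le_succ k)) (by positivity)

end Epoch

/-! ### Counting iterations over the whole run -/

section Run

variable {E : Type*} [NormedAddCommGroup E] [InnerProductSpace ℝ E] [CompleteSpace E]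

/-- The facts that hold in an epoch in which no restart has occurred so far and no averaged
solution has a gradient of norm at most `ε`. -/
structure EpochInv (rule : MRule) (f : E → ℝ) (M₀ ε : ℝ) (s : State E) : Prop where
  L_pos : 0 < s.L
  grad : ∀ j < s.k, ε < ‖gradient f (yBar f s.L s.x₀ (j + 1))‖
  decrease : ∀ j < s.k, f (xSeq f s.L s.x₀ (j + 1))
    ≤ f s.x₀ - s.L * S f s.L s.x₀ (j + 1) / (2 * ((j : ℝ) + 2))
  cond : ∀ j < s.k, ((j : ℝ) + 2) ^ 5 * MEst rule f M₀ s.L s.x₀ (j + 1) ^ 2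
    * S f s.L s.x₀ (j + 1) ≤ s.L ^ 2

lemma EpochInv.start {rule : MRule} {f : E → ℝ} {M₀ ε L : ℝ} {x₀ : E} (hL : 0 < L) :
    EpochInv rule f M₀ ε ⟨x₀, L, 0⟩ :=
  ⟨hL, fun _ h => absurd h (Nat.not_lt_zero _), fun _ h => absurd h (Nat.not_lt_zero _),
    fun _ h => absurd h (Nat.not_lt_zero _)⟩

lemma EpochInv.cond_self {rule : MRule} {f : E → ℝ} {M₀ ε : ℝ} {s : State E}
    (h : EpochInv rule f M₀ ε s) :
    ((s.k : ℝ) + 1) ^ 5 * MEst rule f M₀ s.L s.x₀ s.k ^ 2 * S f s.L s.x₀ s.k ≤ s.L ^ 2 := by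
  rcases hk : s.k with _ | k
  · simp only [S, Finset.range_zero, Finset.sum_empty, mul_zero]
    positivity
  · have := h.cond k (by omega)
    push_cast
    rwa [show (k : ℝ) + 1 + 1 = k + 2 by ring]

lemma EpochInv.le_start {rule : MRule} {f : E → ℝ} {M₀ ε : ℝ} {s : State E}
    (h : EpochInv rule f M₀ ε s) : f (xSeq f s.L s.x₀ s.k) ≤ f s.x₀ := by
  rcases hk : s.k with _ | k
  · exact le_refl _
  · have h1 := h.decrease k (by omega)
    have h2 : 0 ≤ s.L * S f s.L s.x₀ (k + 1) / (2 * ((k : ℝ) + 2)) :=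
      div_nonneg (mul_nonneg h.L_pos.le (S_nonneg ..)) (by positivity)
    linarith

/-- Progress of the algorithm as long as all averaged solutions have large gradient: `nu` and `ns`
count the restarts of the two kinds. -/
lemma state_progress {rule : MRule} {f : E → ℝ} {Linit M₀ α β ε Lf Lbar c δ kmax : ℝ} {xinit : E}
    (hα : 0 < α) (hβ : 0 < β) (hβ1 : β ≤ 1) (hLinit : 0 < Linit) (hLbar : Linit ≤ Lbar)
    (hLfbar : α * Lf ≤ Lbar) (hc : 0 ≤ c)
    (hlen : ∀ s : State E, s.L ≤ Lbar → EpochInv rule f M₀ ε s → (s.k : ℝ) + 1 ≤ kmax)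
    (hsucc : ∀ s : State E, s.L ≤ Lbar → EpochInv rule f M₀ ε s →
      ε < ‖gradient f (yBar f s.L s.x₀ (s.k + 1))‖ →
      s.L ^ 2 < ((s.k : ℝ) + 2) ^ 5 * MEst rule f M₀ s.L s.x₀ (s.k + 1) ^ 2
        * S f s.L s.x₀ (s.k + 1) →
      (s.k : ℝ) + 1 ≤ c * (s.L * S f s.L s.x₀ (s.k + 1) / (2 * ((s.k : ℝ) + 2))) ∧
        δ ≤ s.L * S f s.L s.x₀ (s.k + 1) / (2 * ((s.k : ℝ) + 2)))
    (hfail : ∀ s : State E, EpochInv rule f M₀ ε s →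
      f s.x₀ - s.L * S f s.L s.x₀ (s.k + 1) / (2 * ((s.k : ℝ) + 2))
        < f (xSeq f s.L s.x₀ (s.k + 1)) → s.L < Lf)
    (N : ℕ) (hN : ∀ n < N, ε < ‖gradient f (averaged rule f Linit M₀ α β xinit (n + 1))‖) :
    let s := state rule f Linit M₀ α β xinit N
    EpochInv rule f M₀ ε s ∧ s.L ≤ Lbar ∧ ∃ nu ns : ℕ, s.L = Linit * α ^ nu * β ^ ns ∧
      (N : ℝ) ≤ c * (f xinit - f s.x₀) + nu * kmax + s.k ∧ ns * δ ≤ f xinit - f s.x₀ := by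
  induction N with
  | zero => exact ⟨EpochInv.start hLinit, hLbar, 0, 0, by simp [state], by simp [state], by simp [state]⟩
  | succ N ih =>
    obtain ⟨hinv, hL, nu, ns, hLeq, hcount, hns⟩ := ih fun n hn => hN n (by omega)
    have hg : ε < ‖gradient f (yBar f (state rule f Linit M₀ α β xinit N).L
        (state rule f Linit M₀ α β xinit N).x₀ ((state rule f Linit M₀ α β xinit N).k + 1))‖ :=
      hN N (by omega)
    simp only [state]
    set s := state rule f Linit M₀ α β xinit N
    have e : ((s.k + 1 : ℕ) : ℝ) + 1 = (s.k : ℝ) + 2 := by push_cast; ring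
    have hLpos := hinv.L_pos
    simp only [step, e, Nat.add_sub_cancel]
    split_ifs with h1 h2
    -- First restart: the epoch is charged to `kmax`. The new start is the last point that passed
    -- the test, so f has not increased, and L < L_f before the update keeps α L below `Lbar`.
    · have hlt := hfail s hinv h1
      have hle := hinv.le_start
      have hk := hlen s hL hinv
      refine ⟨EpochInv.start (by positivity), (mul_le_mul_of_nonneg_left hlt.le hα.le).trans hLfbar,
        nu + 1, ns, ?_, ?_, ?_⟩
      · simp only [hLeq]; ring
      · have := mul_le_mul_of_nonneg_left hle hc
        push_cast
        linarith
      · dsimp only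
        linarith
    -- Second restart: the decrease of f pays for all iterations of the epoch through c, and for the
    -- restart itself through δ.
    · obtain ⟨hk, hδ⟩ := hsucc s hL hinv hg h2
      have hdec := not_lt.1 h1
      refine ⟨EpochInv.start (by positivity), (mul_le_of_le_one_left hLpos.le hβ1).trans hL,
        nu, ns + 1, ?_, ?_, ?_⟩
      · simp only [hLeq]; ring
      · have := mul_le_mul_of_nonneg_left hdec hc
        push_cast
        linarith
      · push_cast
        linarith
    · refine ⟨⟨hLpos, ?_, ?_, ?_⟩, hL, nu, ns, hLeq, ?_, hns⟩
      · intro j hj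
        rcases Nat.lt_succ_iff_lt_or_eq.1 hj with hj | rfl
        · exact hinv.grad j hj
        · exact hg
      · intro j hj
        rcases Nat.lt_succ_iff_lt_or_eq.1 hj with hj | rfl
        · exact hinv.decrease j hj
        · exact not_lt.1 h1
      · intro j hj
        rcases Nat.lt_succ_iff_lt_or_eq.1 hj with hj | rfl
        · exact hinv.cond j hj
        · exact not_lt.1 h2
      · push_cast
        linarith

/-- Taking logarithms in L = Linit α^nu β^ns ≤ L̄ bounds nu by ns, and ns is at most Δ/δ. The
resulting bound does not depend on N, so the gradient must become small; the extra 1 before `kmax`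
covers the current epoch. -/
lemma isLeast_of_progress {rule : MRule} {f : E → ℝ} {Linit M₀ α β ε Lbar c δ kmax : ℝ} {xinit : E}
    (hα : 1 < α) (hβ : 0 < β) (hβ1 : β ≤ 1) (hLinit : 0 < Linit)
    (hc : 0 ≤ c) (hδ : 0 < δ) (hkmax : 0 ≤ kmax) (hbdd : BddBelow (Set.range f))
    (hlen : ∀ s : State E, s.L ≤ Lbar → EpochInv rule f M₀ ε s → (s.k : ℝ) + 1 ≤ kmax)
    (hprog : ∀ N : ℕ, (∀ n < N, ε < ‖gradient f (averaged rule f Linit M₀ α β xinit (n + 1))‖) →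
      let s := state rule f Linit M₀ α β xinit N
      EpochInv rule f M₀ ε s ∧ s.L ≤ Lbar ∧ ∃ nu ns : ℕ, s.L = Linit * α ^ nu * β ^ ns ∧
        (N : ℝ) ≤ c * (f xinit - f s.x₀) + nu * kmax + s.k ∧ ns * δ ≤ f xinit - f s.x₀) :
    ∃ K : ℕ, IsLeast {n : ℕ | 1 ≤ n ∧
        ‖gradient f (averaged rule f Linit M₀ α β xinit n)‖ ≤ ε} K ∧
      (K : ℝ) ≤ c * (f xinit - ⨅ x, f x) + (Real.logb α (Lbar / Linit)
        + (f xinit - ⨅ x, f x) / δ * Real.logb α (1 / β) + 1) * kmax := by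
  have hbound : ∀ N : ℕ,
      (∀ n < N, ε < ‖gradient f (averaged rule f Linit M₀ α β xinit (n + 1))‖) →
      ((N + 1 : ℕ) : ℝ) ≤ c * (f xinit - ⨅ x, f x) + (Real.logb α (Lbar / Linit)
        + (f xinit - ⨅ x, f x) / δ * Real.logb α (1 / β) + 1) * kmax := by
    intro N hN
    obtain ⟨hinv, hL, nu, ns, hLeq, hcount, hns⟩ := hprog N hN
    set s := state rule f Linit M₀ α β xinit N
    have hinf : ⨅ x, f x ≤ f s.x₀ := ciInf_le hbdd _
    have hk := hlen s hL hinv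
    have hlogβ : 0 ≤ Real.logb α (1 / β) :=
      Real.logb_nonneg hα (by rw [le_div_iff₀ hβ]; linarith)
    have hns' : (ns : ℝ) ≤ (f xinit - ⨅ x, f x) / δ := by
      rw [le_div_iff₀ hδ]; linarith
    have hα0 : 0 < α := by linarith
    have hnu : (nu : ℝ) ≤ Real.logb α (Lbar / Linit) + ns * Real.logb α (1 / β) := by
      have h1 : α ^ nu ≤ Lbar / Linit * (1 / β) ^ ns := by
        rw [one_div, inv_pow, ← div_eq_mul_inv, le_div_iff₀ (by positivity),
          le_div_iff₀ hLinit]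
        linarith
      have hLb : 0 < Lbar / Linit := div_pos (hinv.L_pos.trans_le hL) hLinit
      have h2 := Real.logb_le_logb_of_le hα (by positivity) h1
      rwa [Real.logb_mul hLb.ne' (by positivity), Real.logb_pow, Real.logb_pow,
        Real.logb_self_eq_one hα, mul_one] at h2
    have h3 : (nu : ℝ) ≤ Real.logb α (Lbar / Linit)
        + (f xinit - ⨅ x, f x) / δ * Real.logb α (1 / β) :=
      hnu.trans (by gcongr)
    have h4 := mul_le_mul_of_nonneg_right h3 hkmax
    have h5 := mul_le_mul_of_nonneg_left hinf hc
    push_cast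
    linarith
  have hex : ∃ n : ℕ, 1 ≤ n ∧ ‖gradient f (averaged rule f Linit M₀ α β xinit n)‖ ≤ ε := by
    by_contra! hcon
    obtain ⟨N, hN⟩ := exists_nat_gt (c * (f xinit - ⨅ x, f x) + (Real.logb α (Lbar / Linit)
        + (f xinit - ⨅ x, f x) / δ * Real.logb α (1 / β) + 1) * kmax)
    have := hbound N fun n _ => hcon (n + 1) (by omega)
    push_cast at this
    linarith
  classical
  refine ⟨Nat.find hex, ⟨Nat.find_spec hex, fun n hn => Nat.find_min' hex hn⟩, ?_⟩
  have h1 : 1 ≤ Nat.find hex := (Nat.find_spec hex).1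
  obtain ⟨N, hN⟩ : ∃ N, Nat.find hex = N + 1 := ⟨Nat.find hex - 1, by omega⟩
  rw [hN]
  refine hbound N fun n hn => ?_
  have := Nat.find_min hex (show n + 1 < Nat.find hex by omega)
  by_contra hcon
  exact this ⟨by omega, not_lt.1 hcon⟩

lemma quarter_root_eq {ρ L M ε : ℝ} (hρ : 0 < ρ) (hL : 0 < L) (hM : 0 < M) (hε : 0 < ε) :
    (4 * ρ * L ^ 2 / (M * ε)) ^ (1 / 4 : ℝ)
      = 2 ^ (1 / 2 : ℝ) * ρ ^ (1 / 4 : ℝ) * L ^ (1 / 2 : ℝ) / (M ^ (1 / 4 : ℝ) * ε ^ (1 / 4 : ℝ)) := by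
  rw [Real.div_rpow (by positivity) (by positivity), Real.mul_rpow (by positivity) (by positivity),
    Real.mul_rpow (by positivity) (by positivity), Real.mul_rpow hM.le hε.le,
    show (4 : ℝ) = 2 ^ (2 : ℝ) by norm_num, ← Real.rpow_mul (by norm_num), ← Real.rpow_natCast L 2,
    ← Real.rpow_mul hL.le]
  norm_num

/-- The iteration bound for any `ρ ≥ 1` such that `ρ M_k` bounds the gradient at the averaged
solutions. -/
theorem iteration_bound {rule : MRule} {f : E → ℝ} {Linit M₀ α β ε Lf Mf ρ : ℝ} {xinit : E}
    (hMf : 0 < Mf) (hLinit : 0 < Linit) (hM₀ : 0 < M₀) (hα : 1 < α) (hβ : 0 < β) (hβ1 : β ≤ 1)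
    (hf : Differentiable ℝ f) (hg : Differentiable ℝ (gradient f))
    (hlip : ∀ x y, ‖gradient f x - gradient f y‖ ≤ Lf * ‖x - y‖)
    (hM : ∀ x y, ‖fderiv ℝ (gradient f) x - fderiv ℝ (gradient f) y‖ ≤ Mf * ‖x - y‖)
    (hbdd : BddBelow (Set.range f)) (hε : 0 < ε) (hρ : 1 ≤ ρ)
    (hε₀ : ε ≤ 4 * max Linit (α * Lf) ^ 2 / M₀)
    (hbound : ∀ (L : ℝ) (x₀ : E), 0 < L → ∀ j, ‖gradient f (yBar f L x₀ (j + 1))‖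
      ≤ 2 * L / ((j : ℝ) + 2) * ‖xSeq f L x₀ (j + 1) - xSeq f L x₀ j‖
        + ρ * MEst rule f M₀ L x₀ (j + 1) * spreadCoeff j * S f L x₀ (j + 1)) :
    ∃ K : ℕ, IsLeast {n : ℕ | 1 ≤ n ∧
        ‖gradient f (averaged rule f Linit M₀ α β xinit n)‖ ≤ ε} K ∧
      (K : ℝ) ≤ (70 + 108 * (max M₀ Mf ^ (1 / 4 : ℝ) / M₀ ^ (1 / 4 : ℝ)) * Real.logb α (1 / β))
          * (ρ ^ (7 / 4 : ℝ) * max Linit (α * Lf) ^ (1 / 2 : ℝ) * max M₀ Mf ^ (1 / 4 : ℝ)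
            / ε ^ (7 / 4 : ℝ) * (f xinit - ⨅ x, f x))
        + (Real.logb α (max Linit (α * Lf) / Linit) + 1)
          * (2 ^ (1 / 2 : ℝ) * ρ ^ (1 / 4 : ℝ) * max Linit (α * Lf) ^ (1 / 2 : ℝ)
            / (M₀ ^ (1 / 4 : ℝ) * ε ^ (1 / 4 : ℝ))) := by
  have hLbar : Linit ≤ max Linit (α * Lf) := le_max_left _ _
  have hLfbar : α * Lf ≤ max Linit (α * Lf) := le_max_right _ _
  set Lbar := max Linit (α * Lf)
  have hMbar0 : M₀ ≤ max M₀ Mf := le_max_left _ _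
  have hMest : ∀ (L : ℝ) (x₀ : E), 0 < L → ∀ k, MEst rule f M₀ L x₀ k ≤ max M₀ Mf :=
    fun L x₀ hL k => MEst_le x₀ rule hf hL hMf.le hg hM k
  set Mbar := max M₀ Mf
  have hLb : 0 < Lbar := hLinit.trans_le hLbar
  have hMb : 0 < Mbar := hM₀.trans_le hMbar0
  have hρ0 : 0 < ρ := by linarith
  have hα0 : 0 < α := by linarith
  have hΔ : 0 ≤ f xinit - ⨅ x, f x := sub_nonneg.2 (ciInf_le hbdd _)
  have hlogβ : 0 ≤ Real.logb α (1 / β) :=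
    Real.logb_nonneg hα (by rw [le_div_iff₀ hβ]; linarith)
  set Q := 4 * ρ * Lbar ^ 2 / (M₀ * ε) with hQ
  -- The restriction on ε serves only here: it makes `kmax` at least 1, as needed for an epoch with
  -- k = 0.
  have hQ1 : 1 ≤ Q := by
    rw [le_div_iff₀ hM₀] at hε₀
    rw [hQ, le_div_iff₀ (by positivity)]
    nlinarith [sq_nonneg Lbar]
  set kmax := Q ^ (1 / 4 : ℝ) with hkmax
  have hk4 : kmax ^ 4 = Q := by
    rw [hkmax, ← Real.rpow_natCast, ← Real.rpow_mul (by linarith)]; norm_num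
  have hkmax0 : 0 ≤ kmax := Real.rpow_nonneg (by linarith) _
  have hlen : ∀ s : State E, s.L ≤ Lbar → EpochInv rule f M₀ ε s → (s.k : ℝ) + 1 ≤ kmax := by
    intro s hsL hinv
    refine (pow_le_pow_iff_left₀ (by positivity) hkmax0 (show (4 : ℕ) ≠ 0 by norm_num)).1 ?_
    rw [hk4]
    rcases Nat.eq_zero_or_pos s.k with hk | hk
    · rw [hk]; norm_num; exact hQ1
    · refine (epoch_length_le hinv.L_pos hM₀ hρ hε hk (hbound s.L s.x₀ hinv.L_pos) hinv.grad
        hinv.cond_self).trans ?_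
      have := hinv.L_pos
      rw [hQ]
      gcongr
  set c := 70 * (ρ ^ (7 / 4 : ℝ) * Lbar ^ (1 / 2 : ℝ) * Mbar ^ (1 / 4 : ℝ) / ε ^ (7 / 4 : ℝ)) with hc
  set δ := ε ^ (3 / 2 : ℝ) / (2 ^ (25 / 4 : ℝ) * ρ ^ (3 / 2 : ℝ) * Mbar ^ (1 / 2 : ℝ)) with hδ
  have hsucc : ∀ s : State E, s.L ≤ Lbar → EpochInv rule f M₀ ε s →
      ε < ‖gradient f (yBar f s.L s.x₀ (s.k + 1))‖ →
      s.L ^ 2 < ((s.k : ℝ) + 2) ^ 5 * MEst rule f M₀ s.L s.x₀ (s.k + 1) ^ 2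
        * S f s.L s.x₀ (s.k + 1) →
      (s.k : ℝ) + 1 ≤ c * (s.L * S f s.L s.x₀ (s.k + 1) / (2 * ((s.k : ℝ) + 2))) ∧
        δ ≤ s.L * S f s.L s.x₀ (s.k + 1) / (2 * ((s.k : ℝ) + 2)) := by
    intro s hsL hinv hgk hviol
    have hL := hinv.L_pos
    have hS := S_nonneg f s.L s.x₀ (s.k + 1)
    have hA := lower_bound_S_succ hL hM₀ hρ hε (hbound s.L s.x₀ hL)
      (fun j hj => (Nat.lt_succ_iff_lt_or_eq.1 hj).elim (hinv.grad j) (fun h => h ▸ hgk))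
      hinv.cond_self
    have hMpos := hM₀.trans_le (le_MEst f s.L s.x₀ rule M₀ (s.k + 1))
    have hMle := hMest s.L s.x₀ hL (s.k + 1)
    have hB : s.L ^ 2 ≤ ((s.k : ℝ) + 1 + 1) ^ 5 * Mbar ^ 2 * S f s.L s.x₀ (s.k + 1) := by
      rw [show (s.k : ℝ) + 1 + 1 = s.k + 2 by ring]
      refine hviol.le.trans ?_
      gcongr
    have hn : (1 : ℝ) ≤ (s.k : ℝ) + 1 := by linarith [(Nat.cast_nonneg s.k : (0 : ℝ) ≤ s.k)]
    have h1 := length_le_of_decrease hε hn hρ0 hL hMb hS hA hB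
    have h2 := le_decrease hε hn hρ0 hL hMb hS hA hB
    rw [show (s.k : ℝ) + 1 + 1 = s.k + 2 by ring] at h1 h2
    refine ⟨h1.trans ?_, h2⟩
    rw [hc]
    gcongr
  have hfail : ∀ s : State E, EpochInv rule f M₀ ε s →
      f s.x₀ - s.L * S f s.L s.x₀ (s.k + 1) / (2 * ((s.k : ℝ) + 2))
        < f (xSeq f s.L s.x₀ (s.k + 1)) → s.L < Lf := by
    intro s hinv hlt
    by_contra hcon
    exact absurd hlt (not_lt.2 (sufficient_decrease s.x₀ rule hinv.L_pos (not_lt.1 hcon) hM₀ hf hlip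
      s.k hinv.cond))
  obtain ⟨K, hK, hKle⟩ := isLeast_of_progress hα hβ hβ1 hLinit (by positivity : 0 ≤ c)
    (by positivity : 0 < δ) hkmax0 hbdd hlen
    (state_progress (xinit := xinit) hα0 hβ hβ1 hLinit hLbar hLfbar (by positivity) hlen hsucc hfail)
  refine ⟨K, hK, hKle.trans ?_⟩
  have hkeq : kmax = 2 ^ (1 / 2 : ℝ) * ρ ^ (1 / 4 : ℝ) * Lbar ^ (1 / 2 : ℝ)
      / (M₀ ^ (1 / 4 : ℝ) * ε ^ (1 / 4 : ℝ)) := quarter_root_eq hρ0 hLb hM₀ hε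
  have hprod : 1 / δ * kmax ≤ 108 * (Mbar ^ (1 / 4 : ℝ) / M₀ ^ (1 / 4 : ℝ))
      * (ρ ^ (7 / 4 : ℝ) * Lbar ^ (1 / 2 : ℝ) * Mbar ^ (1 / 4 : ℝ) / ε ^ (7 / 4 : ℝ)) := by
    have e1 : ε ^ (7 / 4 : ℝ) = ε ^ (3 / 2 : ℝ) * ε ^ (1 / 4 : ℝ) := by
      rw [← Real.rpow_add hε]; norm_num
    have e2 : ρ ^ (7 / 4 : ℝ) = ρ ^ (3 / 2 : ℝ) * ρ ^ (1 / 4 : ℝ) := by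
      rw [← Real.rpow_add hρ0]; norm_num
    have e3 : Mbar ^ (1 / 2 : ℝ) = Mbar ^ (1 / 4 : ℝ) * Mbar ^ (1 / 4 : ℝ) := by
      rw [← Real.rpow_add hMb]; norm_num
    -- The constant 108 is 2^(27/4) rounded up.
    have e4 : (2 : ℝ) ^ (25 / 4 : ℝ) * 2 ^ (1 / 2 : ℝ) ≤ 108 := by
      rw [← Real.rpow_add (by norm_num)]
      refine (pow_le_pow_iff_left₀ (by positivity) (by norm_num) (show (4 : ℕ) ≠ 0 by norm_num)).1 ?_
      rw [← Real.rpow_natCast, ← Real.rpow_mul (by norm_num)]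
      norm_num
    rw [hkeq, hδ, e1, e2, e3, one_div_div]
    calc _ = (2 : ℝ) ^ (25 / 4 : ℝ) * 2 ^ (1 / 2 : ℝ) * ((Mbar ^ (1 / 4 : ℝ) / M₀ ^ (1 / 4 : ℝ))
          * (ρ ^ (3 / 2 : ℝ) * ρ ^ (1 / 4 : ℝ) * Lbar ^ (1 / 2 : ℝ) * Mbar ^ (1 / 4 : ℝ)
            / (ε ^ (3 / 2 : ℝ) * ε ^ (1 / 4 : ℝ)))) := by
          field_simp
      _ ≤ 108 * ((Mbar ^ (1 / 4 : ℝ) / M₀ ^ (1 / 4 : ℝ))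
          * (ρ ^ (3 / 2 : ℝ) * ρ ^ (1 / 4 : ℝ) * Lbar ^ (1 / 2 : ℝ) * Mbar ^ (1 / 4 : ℝ)
            / (ε ^ (3 / 2 : ℝ) * ε ^ (1 / 4 : ℝ)))) :=
          mul_le_mul_of_nonneg_right e4 (by positivity)
      _ = _ := by ring
  have h1 := mul_le_mul_of_nonneg_right hprod (mul_nonneg hΔ hlogβ)
  have e5 : (f xinit - ⨅ x, f x) / δ * Real.logb α (1 / β) * kmax
      = 1 / δ * kmax * ((f xinit - ⨅ x, f x) * Real.logb α (1 / β)) := by ring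
  rw [← hkeq, add_right_comm, add_mul _ _ kmax, e5, hc]
  linarith

end Run

end RestartedAGD

end

theorem mainTheorem1
    (Lf Mf Linit M₀ α : ℝ) (hLf : 0 < Lf) (hMf : 0 < Mf)
    (hLinit : 0 < Linit) (hM₀ : 0 < M₀) (hα : 1 < α) :
    -- the constants of the `O(ε^(-1/4))` term, valid for `ε → 0`
    ∃ C ε₀ : ℝ, 0 ≤ C ∧ 0 < ε₀ ∧
      ∀ (β : ℝ), 0 < β → β ≤ 1 →
      ∀ (d : ℕ) (f : EuclideanSpace ℝ (Fin d) → ℝ),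
        Differentiable ℝ f → Differentiable ℝ (gradient f) →
        (∀ x y, ‖gradient f x - gradient f y‖ ≤ Lf * ‖x - y‖) →
        (∀ x y, ‖fderiv ℝ (gradient f) x - fderiv ℝ (gradient f) y‖ ≤ Mf * ‖x - y‖) →
        BddBelow (Set.range f) →
      ∀ (xinit : EuclideanSpace ℝ (Fin d)) (rule : RestartedAGD.MRule) (ε : ℝ),
        0 < ε → ε ≤ ε₀ →
        let Lbar : ℝ := max Linit (α * Lf)
        let Mbar : ℝ := max M₀ Mf
        let Δ : ℝ := f xinit - ⨅ x, f x
        ∃ K : ℕ,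
          IsLeast {n : ℕ | 1 ≤ n ∧
            ‖gradient f (RestartedAGD.averaged rule f Linit M₀ α β xinit n)‖ ≤ ε} K ∧
          (K : ℝ) ≤
            (70 + 108 * (Mbar ^ (1 / 4 : ℝ) / M₀ ^ (1 / 4 : ℝ)) * Real.logb α (1 / β))
              * (Lbar ^ (1 / 2 : ℝ) * Mbar ^ 2 * Δ / (ε ^ (7 / 4 : ℝ) * M₀ ^ (7 / 4 : ℝ)))
            + C * ε ^ (-(1 / 4) : ℝ) ∧
          (rule = RestartedAGD.MRule.extended → β = 1 →
            (K : ℝ) ≤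
              70 * (Lbar ^ (1 / 2 : ℝ) * Mbar ^ (1 / 4 : ℝ) * Δ / ε ^ (7 / 4 : ℝ))
              + C * ε ^ (-(1 / 4) : ℝ)) := by
  have hLb : 0 < max Linit (α * Lf) := hLinit.trans_le (le_max_left _ _)
  have hMb : 0 < max M₀ Mf := hM₀.trans_le (le_max_left _ _)
  have hρ : 1 ≤ max M₀ Mf / M₀ := by rw [one_le_div hM₀]; exact le_max_left _ _
  have hlog : 0 ≤ Real.logb α (max Linit (α * Lf) / Linit) :=
    Real.logb_nonneg hα (by rw [one_le_div hLinit]; exact le_max_left _ _)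
  -- C is the coefficient of ε^(-1/4) for ρ = M̄/M₀; as ρ ≥ 1, it also covers the application with ρ
  -- = 1.
  refine ⟨(Real.logb α (max Linit (α * Lf) / Linit) + 1)
    * (2 ^ (1 / 2 : ℝ) * (max M₀ Mf / M₀) ^ (1 / 4 : ℝ) * max Linit (α * Lf) ^ (1 / 2 : ℝ)
      / M₀ ^ (1 / 4 : ℝ)), 4 * max Linit (α * Lf) ^ 2 / M₀, by positivity, by positivity, ?_⟩
  intro β hβ hβ1 d f hf hg hlip hM hbdd xinit rule ε hε hε₀
  have hbound : ∀ (L : ℝ) (x₀ : EuclideanSpace ℝ (Fin d)), 0 < L → ∀ j,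
      ‖gradient f (RestartedAGD.yBar f L x₀ (j + 1))‖
      ≤ 2 * L / ((j : ℝ) + 2)
          * ‖RestartedAGD.xSeq f L x₀ (j + 1) - RestartedAGD.xSeq f L x₀ j‖
        + max M₀ Mf / M₀ * RestartedAGD.MEst rule f M₀ L x₀ (j + 1)
          * RestartedAGD.spreadCoeff j * RestartedAGD.S f L x₀ (j + 1) := by
    intro L x₀ hL j
    refine (RestartedAGD.norm_gradient_yBar_le x₀ hL hMf.le hg hM j).trans ?_
    -- M_k may stay at M₀, so M̄/M₀ is the factor that is safe for either rule.
    have h1 : Mf ≤ max M₀ Mf / M₀ * RestartedAGD.MEst rule f M₀ L x₀ (j + 1) := by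
      have h2 := mul_le_mul_of_nonneg_left (RestartedAGD.le_MEst f L x₀ rule M₀ (j + 1))
        (show 0 ≤ max M₀ Mf / M₀ by positivity)
      rw [div_mul_cancel₀ _ hM₀.ne'] at h2
      exact (le_max_right _ _).trans h2
    have := RestartedAGD.spreadCoeff_nonneg j
    have := RestartedAGD.S_nonneg f L x₀ (j + 1)
    gcongr
  obtain ⟨K, hK, hKle⟩ := RestartedAGD.iteration_bound (xinit := xinit) hMf hLinit hM₀ hα hβ hβ1
    hf hg hlip hM hbdd hε hρ hε₀ hbound
  have hεinv : ε ^ (-(1 / 4) : ℝ) = 1 / ε ^ (1 / 4 : ℝ)  :=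
    (Real.rpow_neg hε.le _).trans (one_div _).symm
  refine ⟨K, hK, hKle.trans (le_of_eq ?_), ?_⟩
  · have e1 : (max M₀ Mf / M₀) ^ (7 / 4 : ℝ) * max M₀ Mf ^ (1 / 4 : ℝ)
        = max M₀ Mf ^ 2 / M₀ ^ (7 / 4 : ℝ) := by
      rw [Real.div_rpow hMb.le hM₀.le, div_mul_eq_mul_div, ← Real.rpow_add hMb]
      norm_num
    rw [hεinv, mul_right_comm ((max M₀ Mf / M₀) ^ (7 / 4 : ℝ)), e1]
    congr 1
    · congr 1; ring
    · ring
  · rintro rfl rfl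
    -- The same run is estimated again with ρ = 1; the least index is unique, so both bounds concern
    -- the same K.
    obtain ⟨K', hK', hKle'⟩ := RestartedAGD.iteration_bound (xinit := xinit) hMf hLinit hM₀ hα hβ
      hβ1 hf hg hlip hM hbdd hε le_rfl hε₀ (fun L x₀ hL j => by
        rw [one_mul]; exact RestartedAGD.norm_gradient_yBar_le_MEst x₀ hL hMf.le hg hM j)
    rw [hK.unique hK']
    refine hKle'.trans ?_
    rw [hεinv, Real.one_rpow, Real.one_rpow, div_one, Real.logb_one, mul_zero, add_zero, one_mul,
      mul_one]
    have h1 : 1 ≤ (max M₀ Mf / M₀) ^ (1 / 4 : ℝ) := Real.one_le_rpow hρ (by norm_num)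
    refine add_le_add (le_of_eq (by ring)) ?_
    rw [mul_assoc, mul_one_div, div_div]
    refine mul_le_mul_of_nonneg_left ?_ (by positivity)
    refine div_le_div_of_nonneg_right ?_ (by positivity)
    refine mul_le_mul_of_nonneg_right ?_ (by positivity)
    exact le_mul_of_one_le_right (by positivity) h1
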